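/- Let $H\in(0,1)$, $\alpha\in(0,2)$ and $u<v$ be real numbers. Let $\widetilde M_\alpha$ be a complex-valued rotationally invariant $\alpha$-stable random measure on $\mathbb R$ with Lebesgue control measure, that is, a family of complex random variables $\widetilde M_\alpha(A)$, indexed by the Borel sets $A$ of finite Lebesgue measure $|A|$, which is independent over disjoint sets, almost surely $\sigma$-additive (along each sequence of pairwise disjoint sets whose union has finite measure), and satisfies $$\mathbb E\exp\big(i\,\mathrm{Re}(\overline z\,\widetilde M_\alpha(A))\big)=\exp\big(-|A|\,|z|^\alpha\big)\qquad(z\in\mathbb C).$$ For $f\in L^\alpha(\mathbb R;\mathbb C)$, the integral $\int_{\mathbb R} f\,d\widetilde M_\alpha$ is the limit in probability of the integrals $\sum_k c_k\widetilde M_\alpha(A_k)$ of simple functions $\sum_k c_k\mathbf 1_{A_k}$ (with disjoint Borel sets $A_k$ of finite measure) converging to $f$ in $L^\alpha$. Let $\{X(t),t\in\mathbb R\}$ be the harmonizable fractional stable motion, that is, the real-valued process with almost surely continuous paths such that, for each $t\in\mathbb R$, almost surely $$X(t)=\mathrm{Re}\bigg(\int_{\mathbb R}\frac{e^{it\xi}-1}{|\xi|^{H+1/\alpha}}\,d\widetilde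 M_\alpha(\xi)\bigg).$$ Then, almost surely, $$\sup_{u\le t'<t''\le v}\ \frac{|X(t')-X(t'')|}{|t'-t''|^{H}\,\big(\log(1+|t'-t''|^{-1})\big)^{1/\alpha}}=+\infty .$$ -/

import Mathlib

open MeasureTheory ProbabilityTheory Filter Topology

/-- `M` is a complex-valued rotationally invariant `α`-stable random measure on `ℝ` with Lebesgue
control measure, defined on the Borel sets of finite Lebesgue measure: it is independently
scattered, almost surely `σ`-additive along each disjoint sequence, and
`𝔼 exp (i Re (conj z * M A)) = exp (-|A| |z| ^ α)`.
(`charFun` is taken for the real inner product `Re (conj z * w)` of `ℂ`. The series in the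
`σ`-additivity is the limit of its partial sums, since it need not converge absolutely when
`1 ≤ α`.) -/
structure IsIsotropicStableRandomMeasure {Ω : Type*} [MeasurableSpace Ω] (P : Measure Ω)
    (α : ℝ) (M : Set ℝ → Ω → ℂ) : Prop where
  measurable : ∀ A : Set ℝ, MeasurableSet A → volume A < ⊤ → Measurable (M A)
  charFun_eq : ∀ A : Set ℝ, MeasurableSet A → volume A < ⊤ → ∀ z : ℂ,
    charFun (P.map (M A)) z = Complex.exp ((-((volume A).toReal * ‖z‖ ^ α) : ℝ) : ℂ)
  indep : ∀ A : ℕ → Set ℝ, (∀ n, MeasurableSet (A n)) → (∀ n, volume (A n) < ⊤) →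
    Pairwise (Function.onFun Disjoint A) → iIndepFun (fun n => M (A n)) P
  sigma_additive : ∀ A : ℕ → Set ℝ, (∀ n, MeasurableSet (A n)) → volume (⋃ n, A n) < ⊤ →
    Pairwise (Function.onFun Disjoint A) →
    ∀ᵐ ω ∂P, Tendsto (fun N : ℕ => ∑ n ∈ Finset.range N, M (A n) ω) atTop
      (𝓝 (M (⋃ n, A n) ω))

/-- The integral `∑ c, c * M {f = c}` of a simple function against a random measure. -/
noncomputable def simpleStochasticIntegral {Ω : Type*} (M : Set ℝ → Ω → ℂ)
    (f : SimpleFunc ℝ ℂ) (ω : Ω) : ℂ :=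
  ∑ c ∈ f.range, c * M (f ⁻¹' {c}) ω

/-- `Y` is (a version of) the stochastic integral `∫ f dM` of `f ∈ L^α(ℝ; ℂ)`: the limit in
probability of the integrals of simple functions, supported on sets of finite measure, that
converge to `f` in `L^α`. -/
def IsStochasticIntegral {Ω : Type*} [MeasurableSpace Ω] (P : Measure Ω)
    (α : ℝ) (M : Set ℝ → Ω → ℂ) (f : ℝ → ℂ) (Y : Ω → ℂ) : Prop :=
  MemLp f (ENNReal.ofReal α) volume ∧
  ∃ s : ℕ → SimpleFunc ℝ ℂ,
    (∀ n, (s n).FinMeasSupp volume) ∧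
    Tendsto (fun n => eLpNorm (fun ξ => s n ξ - f ξ) (ENNReal.ofReal α) volume) atTop (𝓝 0) ∧
    TendstoInMeasure P (fun n => simpleStochasticIntegral M (s n)) atTop Y

/-- The kernel `ξ ↦ (e^{itξ} - 1) / |ξ|^{H + 1/α}`. -/
noncomputable def hfsmKernel (H α t : ℝ) (ξ : ℝ) : ℂ :=
  (Complex.exp (Complex.I * t * ξ) - 1) / ((|ξ| ^ (H + 1 / α) : ℝ) : ℂ)

/-- `X` is the harmonizable fractional stable motion driven by `M`: a process with almost surely
continuous paths such that `X t = Re ∫ (e^{itξ} - 1) / |ξ|^{H + 1/α} dM(ξ)` almost surely,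
for each `t`. -/
structure IsHFSM {Ω : Type*} [MeasurableSpace Ω] (P : Measure Ω) (H α : ℝ)
    (M : Set ℝ → Ω → ℂ) (X : ℝ → Ω → ℝ) : Prop where
  randomMeasure : IsIsotropicStableRandomMeasure P α M
  integral_eq : ∀ t : ℝ, ∃ Y : Ω → ℂ,
    IsStochasticIntegral P α M (hfsmKernel H α t) Y ∧ ∀ᵐ ω ∂P, X t ω = (Y ω).re
  continuous_paths : ∀ᵐ ω ∂P, Continuous fun t => X t ω

/-! The supremum is already infinite along the pairs `u`, `u + 2 ^ (-j)`. The increment of lag `2 ^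
(-j)` has a kernel whose `α`-mass on the band `[2 ^ j, 2 ^ (j + 1))` is at least of order `2 ^ (-j H
α)` (`exists_le_lintegral_band`). Its band part `W_j` is therefore at least of order `2 ^ (-j H)`
times a standard isotropic `α`-stable variable `Z`, and the `W_j` are independent because the bands
are disjoint. The modulus is comparable to `2 ^ (-j H) j ^ (1 / α)`, so `W_j` exceeds a given
multiple of it with probability at least `P(|Z| ^ α ≥ C j)`. The sum of these probabilities
diverges, since `E |Z| ^ α = ∞` for `α < 2` (`lintegral_norm_rpow_eq_top_of_charFun`); hence some
`W_j` is large almost surely.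

The rest of the increment, whose frequencies lie off the band, could still cancel `W_j`. Let `j` be
the first index with a large `W_j`. Rotating `W_j` alone does not change its joint law with the
remainder and the earlier band parts. Among `m` suitable fixed phases, at most two rotated copies of
a large number have real part in a given short interval (`exists_phases`), so cancellation costs a
factor `2 / m`. Summing over the disjoint first-index events gives `measure_forall_abs_re_le`: all
increments are small with probability at most `2 / m` plus the probability that no band part is
large. The number of bands tends to infinity, then `m` does.

The argument runs on simple functions, where laws are computed from characteristic functions, and
passes to the increments in probability. -/

open scoped ENNReal ComplexConjugate

/-! ### Simple functions supported on sets of finite measure. -/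

namespace MeasureTheory.SimpleFunc

lemma finMeasSupp_const_mul {f : SimpleFunc ℝ ℂ} (hf : f.FinMeasSupp volume) (c : ℂ) :
    (SimpleFunc.const ℝ c * f).FinMeasSupp volume := by
  rw [SimpleFunc.const_mul_eq_map]
  exact hf.map (by simp)

lemma finMeasSupp_restrict {f : SimpleFunc ℝ ℂ} (hf : f.FinMeasSupp volume) {B : Set ℝ}
    (hB : MeasurableSet B) : (f.restrict B).FinMeasSupp volume := by
  rw [SimpleFunc.finMeasSupp_iff_support] at hf ⊢
  refine (measure_mono ?_).trans_lt hf
  rw [SimpleFunc.coe_restrict _ hB]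
  rw [Set.support_indicator]
  exact Set.inter_subset_right

lemma sum_apply {ι : Type*} (s : Finset ι) (F : ι → SimpleFunc ℝ ℂ) (ξ : ℝ) :
    (∑ i ∈ s, F i) ξ = ∑ i ∈ s, F i ξ := by
  classical
  induction s using Finset.induction_on with
  | empty => simp
  | insert a s ha ih => rw [Finset.sum_insert ha, Finset.sum_insert ha, SimpleFunc.add_apply, ih]

end MeasureTheory.SimpleFunc

/-! ### Almost sure linearity and independence for the random measure. -/

namespace IsIsotropicStableRandomMeasure

variable {Ω : Type*} [MeasurableSpace Ω] {P : Measure Ω} {α : ℝ} {M : Set ℝ → Ω → ℂ}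

/-- Along the constant sequence `∅` the partial sums converge, so their constant difference `M ∅` is
zero. -/
lemma empty_ae (hM : IsIsotropicStableRandomMeasure P α M) : ∀ᵐ ω ∂P, M ∅ ω = 0 := by
  filter_upwards [hM.sigma_additive (fun _ => ∅) (by simp) (by simp)
    (fun _ _ _ => by simp [Function.onFun])] with ω hω
  have h := ((tendsto_add_atTop_iff_nat 1).2 hω).sub hω
  simp only [Finset.sum_range_succ, add_sub_cancel_left, Set.iUnion_empty, sub_self] at h
  exact tendsto_nhds_unique tendsto_const_nhds h

lemma union_ae (hM : IsIsotropicStableRandomMeasure P α M) {A B : Set ℝ}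
    (hA : MeasurableSet A) (hB : MeasurableSet B) (hAf : volume A < ⊤) (hBf : volume B < ⊤)
    (hAB : Disjoint A B) : ∀ᵐ ω ∂P, M (A ∪ B) ω = M A ω + M B ω := by
  let C : ℕ → Set ℝ := fun n => if n = 0 then A else if n = 1 then B else ∅
  have hC : ⋃ n, C n = A ∪ B := by
    ext x
    simp only [Set.mem_iUnion, Set.mem_union, C]
    constructor
    · rintro ⟨n, hn⟩
      split_ifs at hn <;> simp_all
    · rintro (h | h)
      · exact ⟨0, by simpa using h⟩
      · exact ⟨1, by simpa using h⟩
  have hd : Pairwise (Function.onFun Disjoint C) := by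
    intro m n hmn
    simp only [Function.onFun, C]
    split_ifs <;> simp_all [hAB.symm]
  filter_upwards [hM.sigma_additive C (fun n => by simp only [C]; split_ifs <;> simp_all)
    (by rw [hC]; exact measure_union_lt_top hAf hBf) hd, hM.empty_ae] with ω hω h0
  rw [hC] at hω
  refine tendsto_nhds_unique hω (tendsto_const_nhds.congr' ?_)
  filter_upwards [eventually_ge_atTop 2] with N hN
  obtain ⟨k, rfl⟩ := Nat.exists_eq_add_of_le hN
  rw [Finset.sum_range_add, Finset.sum_eq_zero (s := Finset.range k)]
  · simp [Finset.sum_range_succ, C]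
  · intro i _
    have h1 : 2 + i ≠ 1 := by omega
    simp [C, h1, h0]

lemma biUnion_ae (hM : IsIsotropicStableRandomMeasure P α M) {ι : Type*} (s : Finset ι)
    {A : ι → Set ℝ} (hA : ∀ i ∈ s, MeasurableSet (A i)) (hAf : ∀ i ∈ s, volume (A i) < ⊤)
    (hd : (s : Set ι).PairwiseDisjoint A) :
    ∀ᵐ ω ∂P, M (⋃ i ∈ s, A i) ω = ∑ i ∈ s, M (A i) ω := by
  classical
  induction s using Finset.induction_on with
  | empty => simpa using hM.empty_ae
  | insert a s ha ih =>
    have h1 := ih (fun i hi => hA i (by simp [hi])) (fun i hi => hAf i (by simp [hi]))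
      (hd.subset (by simp))
    have h2 := hM.union_ae (A := A a) (B := ⋃ i ∈ s, A i) (hA a (by simp))
      (Finset.measurableSet_biUnion _ fun i hi => hA i (by simp [hi])) (hAf a (by simp))
      ((measure_biUnion_lt_top s.finite_toSet fun i hi => hAf i (by simp_all)))
      (by
        simp only [Set.disjoint_iUnion_right]
        intro i hi
        exact hd (by simp) (by simp [hi]) (fun h => ha (h ▸ hi)))
    filter_upwards [h1, h2] with ω h1 h2
    rw [Finset.set_biUnion_insert, h2, h1, Finset.sum_insert ha]

/-- Source of linearity: applied to `f.pair g`, it writes several integrals over the fibres of one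
common refinement. The condition `g 0 = 0` removes the fibre over `0`, where the measure may be
infinite and `M` is uncontrolled. -/
lemma integral_map_ae (hM : IsIsotropicStableRandomMeasure P α M) {E : Type*} [Zero E]
    {h : SimpleFunc ℝ E} (hf : h.FinMeasSupp volume) {g : E → ℂ} (hg : g 0 = 0) :
    ∀ᵐ ω ∂P, simpleStochasticIntegral M (h.map g) ω
      = ∑ p ∈ h.range, g p * M (h ⁻¹' {p}) ω := by
  classical
  have key : ∀ c ∈ (h.map g).range, ∀ᵐ ω ∂P, c * M ((h.map g) ⁻¹' {c}) ω
      = ∑ p ∈ h.range with g p = c, g p * M (h ⁻¹' {p}) ω := by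
    intro c _
    by_cases hc : c = 0
    · refine .of_forall fun ω => ?_
      subst hc
      rw [Finset.sum_eq_zero]
      · simp
      · intro p hp
        simp [(Finset.mem_filter.1 hp).2]
    · have hU : (h.map g) ⁻¹' {c} = ⋃ p ∈ h.range.filter (fun p => g p = c), h ⁻¹' {p} := by
        ext x
        simp
      have hne : ∀ p ∈ h.range.filter (fun p => g p = c), p ≠ 0 := by
        rintro p hp rfl
        exact hc (by rw [← (Finset.mem_filter.1 hp).2, hg])
      filter_upwards [hM.biUnion_ae (h.range.filter (fun p => g p = c))
        (A := fun p => h ⁻¹' {p}) (fun p _ => h.measurableSet_fiber p)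
        (fun p hp => hf.meas_preimage_singleton_ne_zero (hne p hp))
        (fun p _ q _ hpq => by
          simpa [Function.onFun] using Disjoint.preimage h (by simpa using hpq))] with ω hω
      rw [hU, hω, Finset.mul_sum]
      refine Finset.sum_congr rfl fun p hp => ?_
      rw [(Finset.mem_filter.1 hp).2]
  filter_upwards [(ae_ball_iff (Finset.countable_toSet _)).2 key] with ω hω
  rw [simpleStochasticIntegral, Finset.sum_congr rfl hω]
  refine Finset.sum_fiberwise_of_maps_to (fun p hp => ?_) _
  simp only [SimpleFunc.range_map]
  exact Finset.mem_image_of_mem _ hp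

lemma integral_add_ae (hM : IsIsotropicStableRandomMeasure P α M) {f g : SimpleFunc ℝ ℂ}
    (hf : f.FinMeasSupp volume) (hg : g.FinMeasSupp volume) :
    ∀ᵐ ω ∂P, simpleStochasticIntegral M (f + g) ω
      = simpleStochasticIntegral M f ω + simpleStochasticIntegral M g ω := by
  have hp : (f.pair g).FinMeasSupp volume := hf.pair hg
  filter_upwards [hM.integral_map_ae hp (g := fun p => p.1 + p.2) (by simp),
    hM.integral_map_ae hp (g := Prod.fst) rfl, hM.integral_map_ae hp (g := Prod.snd) rfl]
    with ω h1 h2 h3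
  rw [SimpleFunc.map_fst_pair] at h2
  rw [SimpleFunc.map_snd_pair] at h3
  rw [SimpleFunc.add_eq_map₂, h1, h2, h3, ← Finset.sum_add_distrib]
  simp only [add_mul]

lemma integral_const_mul_ae (hM : IsIsotropicStableRandomMeasure P α M) {f : SimpleFunc ℝ ℂ}
    (hf : f.FinMeasSupp volume) (c : ℂ) :
    ∀ᵐ ω ∂P, simpleStochasticIntegral M (SimpleFunc.const ℝ c * f) ω
      = c * simpleStochasticIntegral M f ω := by
  filter_upwards [hM.integral_map_ae hf (g := fun a => c * a) (by simp)] with ω h1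
  rw [SimpleFunc.const_mul_eq_map, h1, simpleStochasticIntegral, Finset.mul_sum]
  simp only [mul_assoc]

lemma integral_sum_ae (hM : IsIsotropicStableRandomMeasure P α M) {ι : Type*} (s : Finset ι)
    {F : ι → SimpleFunc ℝ ℂ} (hF : ∀ i, (F i).FinMeasSupp volume) (c : ι → ℂ) :
    (∑ i ∈ s, SimpleFunc.const ℝ (c i) * F i).FinMeasSupp volume ∧
    ∀ᵐ ω ∂P, simpleStochasticIntegral M (∑ i ∈ s, SimpleFunc.const ℝ (c i) * F i) ω
      = ∑ i ∈ s, c i * simpleStochasticIntegral M (F i) ω := by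
  classical
  induction s using Finset.induction_on with
  | empty =>
    refine ⟨by simp [SimpleFunc.finMeasSupp_iff_support], .of_forall fun ω => ?_⟩
    simp only [Finset.sum_empty, simpleStochasticIntegral]
    refine Finset.sum_eq_zero fun c hc => ?_
    obtain ⟨x, rfl⟩ := SimpleFunc.mem_range.1 hc
    simp
  | insert a s ha ih =>
    rw [Finset.sum_insert ha]
    refine ⟨(SimpleFunc.finMeasSupp_const_mul (hF a) _).add ih.1, ?_⟩
    filter_upwards [ih.2, hM.integral_add_ae (SimpleFunc.finMeasSupp_const_mul (hF a) (c a)) ih.1,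
      hM.integral_const_mul_ae (hF a) (c a)] with ω h1 h2 h3
    rw [h2, h3, h1, Finset.sum_insert ha]

lemma measurable_integral (hM : IsIsotropicStableRandomMeasure P α M) {f : SimpleFunc ℝ ℂ}
    (hf : f.FinMeasSupp volume) : Measurable (simpleStochasticIntegral M f) := by
  refine Finset.measurable_fun_sum _ fun c _ => ?_
  by_cases hc : c = 0
  · simp [hc]
  · exact (hM.measurable _ (f.measurableSet_fiber c)
      (hf.meas_preimage_singleton_ne_zero hc)).const_mul c

/-- The finite family is embedded in a sequence and padded with `∅`. -/
lemma iIndepFun_of_finite (hM : IsIsotropicStableRandomMeasure P α M) {ι : Type*} [Fintype ι]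
    {A : ι → Set ℝ} (hA : ∀ i, MeasurableSet (A i)) (hAf : ∀ i, volume (A i) < ⊤)
    (hd : Pairwise (Function.onFun Disjoint A)) : iIndepFun (fun i => M (A i)) P := by
  let e : ι → ℕ := fun i => Fintype.equivFin ι i
  have he : Function.Injective e := Fin.val_injective.comp (Fintype.equivFin ι).injective
  let B : ℕ → Set ℝ := Function.extend e A fun _ => ∅
  have hBA : ∀ i, B (e i) = A i := fun i => he.extend_apply A _ i
  have hB : ∀ n, (∃ i, e i = n) ∨ B n = ∅ := by
    intro n
    by_cases h : ∃ i, e i = n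
    · exact .inl h
    · exact .inr (Function.extend_apply' _ _ _ h)
  have key := hM.indep B
    (fun n => by
      rcases hB n with ⟨i, rfl⟩ | h
      · rw [hBA]; exact hA i
      · rw [h]; exact .empty)
    (fun n => by
      rcases hB n with ⟨i, rfl⟩ | h
      · rw [hBA]; exact hAf i
      · simp [h])
    (fun m n hmn => by
      rcases hB m with ⟨i, rfl⟩ | h
      · rcases hB n with ⟨j, rfl⟩ | h
        · simp only [Function.onFun, hBA]
          exact hd fun h => hmn (h ▸ rfl)
        · simp [Function.onFun, h]
      · simp [Function.onFun, h])
  have := key.precomp he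
  simpa only [Function.comp_def, hBA] using this

end IsIsotropicStableRandomMeasure

/-! ### Laws of integrals of simple functions, by characteristic functions. -/

/-- The `α`-th power of the scale parameter of the stable variable `∫ f dM`. -/
noncomputable def stableScale (α : ℝ) (f : ℝ → ℂ) : ℝ := (∫⁻ ξ, ‖f ξ‖ₑ ^ α).toReal

lemma stableScale_simpleFunc {α : ℝ} (hα : 0 < α) {f : SimpleFunc ℝ ℂ}
    (hf : f.FinMeasSupp volume) :
    stableScale α f = ∑ c ∈ f.range, (volume (f ⁻¹' {c})).toReal * ‖c‖ ^ α := by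
  have h := (f.map fun c => ‖c‖ₑ ^ α).lintegral_eq_lintegral volume
  rw [SimpleFunc.map_lintegral] at h
  have h' : stableScale α f = (∫⁻ ξ, (f.map fun c => ‖c‖ₑ ^ α) ξ).toReal := rfl
  rw [h', h, ENNReal.toReal_sum]
  · refine Finset.sum_congr rfl fun c _ => ?_
    rw [ENNReal.toReal_mul, ← ENNReal.toReal_rpow, toReal_enorm, mul_comm]
  · intro c _
    by_cases hc : c = 0
    · simp [hc, hα]
    · exact ENNReal.mul_ne_top (by simp [hα.le])
        (hf.meas_preimage_singleton_ne_zero hc).ne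

lemma charFun_map_const_mul {Ω : Type*} [MeasurableSpace Ω] {P : Measure Ω} {Y : Ω → ℂ}
    (hY : AEMeasurable Y P) (c z : ℂ) :
    charFun (P.map fun ω => c * Y ω) z = charFun (P.map Y) (conj c * z) := by
  rw [charFun_apply, charFun_apply, integral_map (by fun_prop) (by fun_prop),
    integral_map hY (by fun_prop)]
  simp only [Complex.inner, map_mul]
  refine integral_congr_ae (.of_forall fun ω => ?_)
  simp only
  congr 4
  ring

namespace IsIsotropicStableRandomMeasure

variable {Ω : Type*} [MeasurableSpace Ω] {P : Measure Ω} {α : ℝ} {M : Set ℝ → Ω → ℂ}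

lemma charFun_integral (hM : IsIsotropicStableRandomMeasure P α M) (hα : 0 < α)
    {f : SimpleFunc ℝ ℂ} (hf : f.FinMeasSupp volume) (z : ℂ) :
    charFun (P.map (simpleStochasticIntegral M f)) z
      = Complex.exp ((-(stableScale α f * ‖z‖ ^ α) : ℝ) : ℂ) := by
  classical
  -- The value `0` contributes nothing, and its fibre has infinite measure, so it is dropped before
  -- independence is used.
  let s := f.range.erase 0
  let A : s → Set ℝ := fun c => f ⁻¹' {c.1}
  have hne : ∀ c : s, c.1 ≠ 0 := fun c => Finset.ne_of_mem_erase c.2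
  have hAm : ∀ c, MeasurableSet (A c) := fun c => f.measurableSet_fiber c.1
  have hAf : ∀ c, volume (A c) < ⊤ := fun c => hf.meas_preimage_singleton_ne_zero (hne c)
  have hind := hM.iIndepFun_of_finite hAm hAf (fun c d hcd => by
    exact Disjoint.preimage f (Set.disjoint_singleton.2 fun h => hcd (Subtype.ext h)))
  have hind' : iIndepFun (fun (c : s) ω => c.1 * M (A c) ω) P :=
    hind.comp (fun (c : s) w => c.1 * w) (fun c => by fun_prop)
  have hI : simpleStochasticIntegral M f = fun ω => ∑ c : s, c.1 * M (A c) ω := by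
    ext ω
    rw [simpleStochasticIntegral, Finset.sum_coe_sort s fun c => c * M (f ⁻¹' {c}) ω]
    exact (Finset.sum_erase _ (by simp)).symm
  have hmeas : ∀ c, Measurable (M (A c)) := fun c => hM.measurable _ (hAm c) (hAf c)
  have hsum : (fun ω => ∑ c : s, c.1 * M (A c) ω) = ∑ c : s, fun ω => c.1 * M (A c) ω := by
    ext ω
    rw [Finset.sum_apply]
  rw [hI, hsum, hind'.charFun_map_sum_eq_prod (fun c => ((hmeas c).const_mul _).aemeasurable),
    Finset.prod_apply]
  simp_rw [charFun_map_const_mul (hmeas _).aemeasurable, hM.charFun_eq _ (hAm _) (hAf _)]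
  rw [← Complex.exp_sum, ← Complex.ofReal_sum, stableScale_simpleFunc hα hf,
    ← Finset.sum_erase f.range (a := 0) (by simp [hα.ne']),
    ← Finset.sum_coe_sort s fun c => (volume (f ⁻¹' {c})).toReal * ‖c‖ ^ α]
  congr 2
  rw [Finset.sum_neg_distrib, Finset.sum_mul]
  congr 1
  refine Finset.sum_congr rfl fun c _ => ?_
  rw [norm_mul, RCLike.norm_conj, Real.mul_rpow (norm_nonneg _) (norm_nonneg _), mul_assoc]

/-- Cramér–Wold: the inner product with `z` is the real part of one integral, that of `∑ i, conj (z
i) * F i`, whose characteristic function is evaluated at `1`. -/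
lemma charFun_integral_vector (hM : IsIsotropicStableRandomMeasure P α M) (hα : 0 < α)
    {ι : Type*} [Fintype ι] {F : ι → SimpleFunc ℝ ℂ} (hF : ∀ i, (F i).FinMeasSupp volume)
    (z : EuclideanSpace ℂ ι) :
    charFun (P.map fun ω => WithLp.toLp 2 fun i => simpleStochasticIntegral M (F i) ω) z
      = Complex.exp ((-stableScale α fun ξ => ∑ i, conj (z i) * F i ξ : ℝ) : ℂ) := by
  obtain ⟨hfin, hsum⟩ := hM.integral_sum_ae Finset.univ hF fun i => conj (z i)
  have h1 := hM.charFun_integral hα hfin 1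
  have hm : Measurable fun ω => WithLp.toLp 2 fun i => simpleStochasticIntegral M (F i) ω :=
    (WithLp.measurable_toLp 2 _).comp
      (measurable_pi_lambda _ fun i => hM.measurable_integral (hF i))
  have hco : ((∑ i, SimpleFunc.const ℝ (conj (z i)) * F i : SimpleFunc ℝ ℂ) : ℝ → ℂ)
      = fun ξ => ∑ i, conj (z i) * F i ξ := by
    ext ξ
    rw [SimpleFunc.sum_apply]
    rfl
  rw [norm_one, Real.one_rpow, mul_one, hco] at h1
  rw [← h1, charFun_apply, charFun_apply, integral_map hm.aemeasurable (by fun_prop),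
    integral_map (hM.measurable_integral hfin).aemeasurable (by fun_prop)]
  refine integral_congr_ae ?_
  filter_upwards [hsum] with ω hω
  rw [hω, PiLp.inner_apply, sum_inner]
  congr 3
  refine Finset.sum_congr rfl fun i _ => ?_
  simp only [Complex.inner, map_mul, Complex.conj_conj]
  rw [one_mul, mul_comm]

/-- The joint characteristic function sees the integrands only through the moduli of their linear
combinations. -/
lemma map_integral_vector_eq (hM : IsIsotropicStableRandomMeasure P α M)
    [IsProbabilityMeasure P] (hα : 0 < α) {ι : Type*} [Fintype ι] {F G : ι → SimpleFunc ℝ ℂ}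
    (hF : ∀ i, (F i).FinMeasSupp volume) (hG : ∀ i, (G i).FinMeasSupp volume)
    (hFG : ∀ (z : ι → ℂ) (ξ : ℝ), ‖∑ i, z i * F i ξ‖ = ‖∑ i, z i * G i ξ‖) :
    (P.map fun ω i => simpleStochasticIntegral M (F i) ω)
      = P.map fun ω i => simpleStochasticIntegral M (G i) ω := by
  have hmF : Measurable fun ω i => simpleStochasticIntegral M (F i) ω :=
    measurable_pi_lambda _ fun i => hM.measurable_integral (hF i)
  have hmG : Measurable fun ω i => simpleStochasticIntegral M (G i) ω :=
    measurable_pi_lambda _ fun i => hM.measurable_integral (hG i)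
  have key : (P.map fun ω => WithLp.toLp 2 fun i => simpleStochasticIntegral M (F i) ω)
      = P.map fun ω => WithLp.toLp 2 fun i => simpleStochasticIntegral M (G i) ω := by
    refine Measure.ext_of_charFun ?_
    ext z
    rw [hM.charFun_integral_vector hα hF, hM.charFun_integral_vector hα hG]
    congr 3
    unfold stableScale
    congr 1
    refine lintegral_congr fun ξ => ?_
    rw [← ofReal_norm, ← ofReal_norm, hFG]
  have := congrArg (Measure.map (WithLp.ofLp (p := 2) (V := ι → ℂ))) key
  have hmF' : Measurable fun ω => WithLp.toLp 2 fun i => simpleStochasticIntegral M (F i) ω :=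
    (WithLp.measurable_toLp 2 _).comp hmF
  have hmG' : Measurable fun ω => WithLp.toLp 2 fun i => simpleStochasticIntegral M (G i) ω :=
    (WithLp.measurable_toLp 2 _).comp hmG
  rwa [Measure.map_map (WithLp.measurable_ofLp 2 _) hmF',
    Measure.map_map (WithLp.measurable_ofLp 2 _) hmG'] at this

/-- At each `ξ` at most one summand is nonzero, so the `α`-th power of the modulus is additive and
the characteristic function factorizes. -/
lemma iIndepFun_integral (hM : IsIsotropicStableRandomMeasure P α M)
    [IsProbabilityMeasure P] (hα : 0 < α) {ι : Type*} [Fintype ι] {F : ι → SimpleFunc ℝ ℂ}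
    (hF : ∀ i, (F i).FinMeasSupp volume)
    (hd : ∀ i j, i ≠ j → ∀ ξ, F i ξ = 0 ∨ F j ξ = 0) :
    iIndepFun (fun i => simpleStochasticIntegral M (F i)) P := by
  classical
  rw [iIndepFun_iff_charFun_pi fun i => (hM.measurable_integral (hF i)).aemeasurable]
  intro z
  rw [hM.charFun_integral_vector hα hF]
  simp_rw [hM.charFun_integral hα (hF _)]
  rw [← Complex.exp_sum, ← Complex.ofReal_sum, Finset.sum_neg_distrib]
  congr 3
  have hpt : ∀ ξ, ‖∑ i, conj (z i) * F i ξ‖ₑ ^ α = ∑ i, ‖F i ξ‖ₑ ^ α * ‖z i‖ₑ ^ α := by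
    intro ξ
    by_cases h : ∃ i, F i ξ ≠ 0
    · obtain ⟨i, hi⟩ := h
      have h0 : ∀ j, j ≠ i → F j ξ = 0 := fun j hj => (hd j i hj ξ).resolve_right hi
      rw [Finset.sum_eq_single i (by intro j _ hj; simp [h0 j hj]) (by simp),
        Finset.sum_eq_single i (by intro j _ hj; simp [h0 j hj, hα]) (by simp), enorm_mul,
        ENNReal.mul_rpow_of_nonneg _ _ hα.le, mul_comm, ← ofReal_norm (conj (z i)),
        RCLike.norm_conj, ofReal_norm]
    · push Not at h
      simp [h, hα]
  unfold stableScale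
  simp_rw [hpt]
  have hmeas : ∀ i, Measurable fun ξ => ‖F i ξ‖ₑ ^ α := fun i =>
    ((F i).measurable.enorm).pow_const α
  rw [lintegral_finsetSum _ fun i _ => (hmeas i).mul_const _, ENNReal.toReal_sum]
  · refine Finset.sum_congr rfl fun i _ => ?_
    rw [lintegral_mul_const _ (hmeas i), ENNReal.toReal_mul, ← ENNReal.toReal_rpow (‖z i‖ₑ),
      toReal_enorm]
  · intro i _
    rw [lintegral_mul_const _ (hmeas i)]
    refine ENNReal.mul_ne_top ?_ (by simp [hα.le])
    have h1 := ((hF i).map (g := fun c => ‖c‖ₑ ^ α) (by simp [hα])).lintegral_lt_top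
      (.of_forall fun ξ => by simp [hα.le])
    rw [← SimpleFunc.lintegral_eq_lintegral] at h1
    exact h1.ne

end IsIsotropicStableRandomMeasure

/-! ### Phases that defeat cancellation. -/

/-- Three distinct points of the unit circle are not collinear. -/
lemma cross_ne_zero_of_norm_eq_one {x y z : ℂ} (hx : ‖x‖ = 1) (hy : ‖y‖ = 1) (hz : ‖z‖ = 1)
    (hxy : x ≠ y) (hxz : x ≠ z) (hyz : y ≠ z) :
    (x - z).re * (y - z).im - (x - z).im * (y - z).re ≠ 0 := by
  intro h
  have e : ∀ w : ℂ, ‖w‖ = 1 → w.re * w.re + w.im * w.im = 1 := fun w hw => by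
    rw [← Complex.normSq_apply, Complex.normSq_eq_norm_sq, hw, one_pow]
  have ex := e x hx
  have ey := e y hy
  have ez := e z hz
  simp only [Complex.sub_re, Complex.sub_im] at h
  obtain ⟨a, ha⟩ : ∃ a, a = x.re - z.re := ⟨_, rfl⟩
  obtain ⟨b, hb⟩ : ∃ b, b = x.im - z.im := ⟨_, rfl⟩
  obtain ⟨c, hc⟩ : ∃ c, c = y.re - z.re := ⟨_, rfl⟩
  obtain ⟨d, hd⟩ : ∃ d, d = y.im - z.im := ⟨_, rfl⟩
  have h1 : a * a + b * b + 2 * (z.re * a + z.im * b) = 0 := by rw [ha, hb]; linarith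
  have h2 : c * c + d * d + 2 * (z.re * c + z.im * d) = 0 := by rw [hc, hd]; linarith
  rw [← ha, ← hb, ← hc, ← hd] at h
  have hab : a ≠ 0 ∨ b ≠ 0 := by
    by_contra! hh
    exact hxz (Complex.ext (by linarith [hh.1]) (by linarith [hh.2]))
  have hcd : c ≠ 0 ∨ d ≠ 0 := by
    by_contra! hh
    exact hyz (Complex.ext (by linarith [hh.1]) (by linarith [hh.2]))
  -- A vanishing cross product puts `y` on the line through `z` and `x`, at parameter `t`. That line
  -- meets the circle only at `t = 0` (excluded by `y ≠ z`) and `t = 1` (excluded by `x ≠ y`).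
  obtain ⟨t, hct, hdt⟩ : ∃ t, c = t * a ∧ d = t * b := by
    rcases hab with h' | h'
    · exact ⟨c / a, by field_simp, by field_simp; linarith⟩
    · exact ⟨d / b, by field_simp; linarith, by field_simp⟩
  have ht : t ≠ 0 := by
    intro ht
    rw [ht, zero_mul] at hct hdt
    exact hcd.elim (absurd hct) (absurd hdt)
  have hpos : a * a + b * b ≠ 0 := by
    rcases hab with h' | h'
    · have := mul_self_pos.2 h'; nlinarith [mul_self_nonneg b]
    · have := mul_self_pos.2 h'; nlinarith [mul_self_nonneg a]
  have ht1 : t = 1 := by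
    have : t * ((t - 1) * (a * a + b * b)) = 0 := by
      rw [hct, hdt] at h2
      linear_combination h2 - t * h1
    have h3 := (mul_eq_zero.1 ((mul_eq_zero.1 this).resolve_left ht)).resolve_right hpos
    linarith
  subst ht1
  exact hxy (Complex.ext (by linarith) (by linarith))

/-- Cramer's rule: for `a`, `b` independent over `ℝ`, the real parts of `a * w` and `b * w`
determine `w`. -/
lemma norm_mul_cross_le (a b w : ℂ) :
    |a.re * b.im - a.im * b.re| * ‖w‖ ≤ |(a * w).re| * ‖b‖ + |(b * w).re| * ‖a‖ := by
  have h : ((a.re * b.im - a.im * b.re : ℝ) : ℂ) * w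
      = ((a * w).re : ℂ) * (Complex.I * conj b) - ((b * w).re : ℂ) * (Complex.I * conj a) := by
    apply Complex.ext <;> simp <;> ring
  calc |a.re * b.im - a.im * b.re| * ‖w‖
      = ‖((a.re * b.im - a.im * b.re : ℝ) : ℂ) * w‖ := by
        rw [norm_mul, Complex.norm_real, Real.norm_eq_abs]
    _ ≤ _ := by
      rw [h]
      refine (norm_sub_le _ _).trans (le_of_eq ?_)
      simp only [norm_mul, Complex.norm_real, Real.norm_eq_abs, Complex.norm_I, RCLike.norm_conj,
        one_mul]

/-- There are arbitrarily many phases such that, for a large complex number `w`, at most two of the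
rotated numbers have real part in a given short interval. -/
lemma exists_phases (m : ℕ) : ∃ (ζ : Fin m → ℂ) (K : ℝ), 0 < K ∧ (∀ l, ‖ζ l‖ = 1) ∧
    ∀ (w : ℂ) (r b : ℝ), 0 < b → K * b ≤ ‖w‖ →
      (Finset.univ.filter fun l => |(ζ l * w).re + r| ≤ b).card ≤ 2 := by
  let ζ : Fin m → ℂ := fun l => ⟨1 / (l + 1), Real.sqrt (1 - (1 / (l + 1)) ^ 2)⟩
  have hζ : ∀ l, ‖ζ l‖ = 1 := by
    intro l
    have h1 : (1 / ((l : ℝ) + 1)) ^ 2 ≤ 1 := by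
      apply pow_le_one₀ (by positivity)
      rw [div_le_one (by positivity)]
      linarith [(Nat.cast_nonneg (l : ℕ) : (0 : ℝ) ≤ _)]
    rw [← sq_eq_sq₀ (norm_nonneg _) zero_le_one, ← Complex.normSq_eq_norm_sq,
      Complex.normSq_apply, Real.mul_self_sqrt (by linarith)]
    ring
  have hinj : Function.Injective ζ := by
    intro k l h
    have h1 : 1 / ((k : ℝ) + 1) = 1 / ((l : ℝ) + 1) := congrArg Complex.re h
    rw [one_div, one_div, inv_inj] at h1
    exact Fin.ext (by exact_mod_cast (add_right_cancel h1))
  -- If three phases fall in the interval, Cramer's rule bounds `D * ‖w‖` by `8 * b`; the constant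
  -- `9` makes the contradiction strict. Triples with a repeated index have `D = 0` and give the
  -- harmless value `9 / 0 = 0`.
  obtain ⟨K, hK⟩ := Finite.exists_le fun p : Fin m × Fin m × Fin m =>
    9 / |(ζ p.1 - ζ p.2.2).re * (ζ p.2.1 - ζ p.2.2).im
      - (ζ p.1 - ζ p.2.2).im * (ζ p.2.1 - ζ p.2.2).re|
  refine ⟨ζ, max K 1, by positivity, hζ, fun w r b hb hw => ?_⟩
  by_contra! hcard
  obtain ⟨x, y, z, hx, hy, hz, hxy, hxz, hyz⟩ := Finset.two_lt_card_iff.1 hcard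
  simp only [Finset.mem_filter, Finset.mem_univ, true_and] at hx hy hz
  have hd := abs_pos.2 (cross_ne_zero_of_norm_eq_one (hζ x) (hζ y) (hζ z)
    (hinj.ne hxy) (hinj.ne hxz) (hinj.ne hyz))
  have h9 := hK (x, y, z)
  simp only at h9
  rw [div_le_iff₀ hd] at h9
  have hle := norm_mul_cross_le (ζ x - ζ z) (ζ y - ζ z) w
  set D := |(ζ x - ζ z).re * (ζ y - ζ z).im - (ζ x - ζ z).im * (ζ y - ζ z).re|
  have hre : ∀ k, |(ζ k * w).re + r| ≤ b → |((ζ k - ζ z) * w).re| ≤ 2 * b := by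
    intro k hk
    rw [sub_mul, Complex.sub_re, abs_le]
    rw [abs_le] at hk hz
    constructor <;> linarith [hk.1, hk.2, hz.1, hz.2]
  have hn : ∀ k, ‖ζ k - ζ z‖ ≤ 2 := fun k =>
    (norm_sub_le _ _).trans (by rw [hζ, hζ]; norm_num)
  have h8 : |((ζ x - ζ z) * w).re| * ‖ζ y - ζ z‖ + |((ζ y - ζ z) * w).re| * ‖ζ x - ζ z‖
      ≤ 2 * b * 2 + 2 * b * 2 := by
    gcongr
    exacts [hre x hx, hn y, hre y hy, hn x]
  have h10 : 9 * b ≤ D * ‖w‖ := calc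
    9 * b ≤ K * D * b := by gcongr
    _ = D * (K * b) := by ring
    _ ≤ D * (max K 1 * b) := by gcongr; exact le_max_left _ _
    _ ≤ D * ‖w‖ := by gcongr
  linarith

/-! ### Heavy tails: the infinite `α`-th moment. -/

lemma one_sub_cos_le_rpow {α : ℝ} (hα0 : 0 < α) (hα2 : α < 2) (y : ℝ) :
    1 - Real.cos y ≤ 2 * |y| ^ α := by
  rcases le_total |y| 1 with h | h
  · have h1 : |y| ^ (2 : ℝ) ≤ |y| ^ α := by
      rcases eq_or_lt_of_le (abs_nonneg y) with h0 | h0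
      · rw [← h0, Real.zero_rpow two_ne_zero, Real.zero_rpow hα0.ne']
      · exact Real.rpow_le_rpow_of_exponent_ge h0 h hα2.le
    rw [Real.rpow_two, sq_abs] at h1
    have := Real.one_sub_sq_div_two_le_cos (x := y)
    nlinarith [sq_nonneg y]
  · have h1 : 1 ≤ |y| ^ α := Real.one_le_rpow h hα0.le
    linarith [Real.neg_one_le_cos y]

/-- The absolute moment of order `α` of an isotropic `α`-stable law is infinite if `α < 2`. -/
lemma lintegral_norm_rpow_eq_top_of_charFun {α : ℝ} (hα0 : 0 < α) (hα2 : α < 2) {μ : Measure ℂ}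
    [IsProbabilityMeasure μ]
    (hμ : ∀ z : ℂ, charFun μ z = Complex.exp ((-(‖z‖ ^ α) : ℝ) : ℂ)) :
    ∫⁻ w, ENNReal.ofReal (‖w‖ ^ α) ∂μ = ⊤ := by
  by_contra hfin
  have hmeas : Measurable fun w : ℂ => ‖w‖ ^ α := by fun_prop
  have hint : Integrable (fun w : ℂ => ‖w‖ ^ α) μ :=
    ⟨hmeas.aestronglyMeasurable, by
      rw [hasFiniteIntegral_iff_ofReal (.of_forall fun w => by positivity)]
      exact lt_top_iff_ne_top.2 hfin⟩
  let t : ℕ → ℝ := fun n => 1 / ((n : ℝ) + 1)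
  have ht0 : ∀ n, 0 < t n := fun n => by positivity
  have ht1 : ∀ n, t n ≤ 1 := fun n => by
    simp only [t]
    rw [div_le_one (by positivity)]
    linarith [(Nat.cast_nonneg n : (0 : ℝ) ≤ _)]
  have httend : Tendsto t atTop (𝓝 0) := tendsto_one_div_add_atTop_nhds_zero_nat
  -- These quotients tend to `0` pointwise because `1 - cos` is quadratic at `0` and `α < 2`. A
  -- finite moment would dominate them, yet their integrals equal `(1 - exp (-(t n ^ α))) / t n ^
  -- α`, which stays above `1 / 2`.
  let f : ℕ → ℂ → ℝ := fun n w => (1 - Real.cos (t n * w.re)) / t n ^ α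
  have hfm : ∀ n, Measurable (f n) := fun n => by fun_prop
  have hlim : Tendsto (fun n => ∫ w, f n w ∂μ) atTop (𝓝 (∫ _, (0 : ℝ) ∂μ)) := by
    refine tendsto_integral_of_dominated_convergence (fun w => 2 * ‖w‖ ^ α)
      (fun n => (hfm n).aestronglyMeasurable) (hint.const_mul 2) (fun n => ?_) ?_
    · refine .of_forall fun w => ?_
      have hp : 0 < t n ^ α := Real.rpow_pos_of_pos (ht0 n) _
      rw [Real.norm_eq_abs, abs_of_nonneg (div_nonneg (by linarith [Real.cos_le_one (t n * w.re)])
        hp.le), div_le_iff₀ hp]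
      refine (one_sub_cos_le_rpow hα0 hα2 _).trans ?_
      rw [abs_mul, abs_of_pos (ht0 n), Real.mul_rpow (ht0 n).le (abs_nonneg _)]
      have : |w.re| ^ α ≤ ‖w‖ ^ α :=
        Real.rpow_le_rpow (abs_nonneg _) (Complex.abs_re_le_norm w) hα0.le
      nlinarith
    · refine .of_forall fun w => ?_
      have h1 : Tendsto (fun n => t n ^ (2 - α) * (w.re ^ 2 / 2)) atTop (𝓝 0) := by
        have := (httend.rpow_const (p := 2 - α) (.inr (by linarith))).mul_const (w.re ^ 2 / 2)
        rwa [Real.zero_rpow (by linarith), zero_mul] at this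
      refine squeeze_zero (fun n => div_nonneg (by linarith [Real.cos_le_one (t n * w.re)])
        (Real.rpow_pos_of_pos (ht0 n) _).le) (fun n => ?_) h1
      rw [div_le_iff₀ (Real.rpow_pos_of_pos (ht0 n) _)]
      have h2 : t n ^ (2 - α) * t n ^ α = t n ^ 2 := by
        rw [← Real.rpow_add (ht0 n), sub_add_cancel, Real.rpow_two]
      have := Real.one_sub_sq_div_two_le_cos (x := t n * w.re)
      calc 1 - Real.cos (t n * w.re) ≤ (t n * w.re) ^ 2 / 2 := by linarith
        _ = (t n ^ (2 - α) * t n ^ α) * (w.re ^ 2 / 2) := by rw [h2]; ring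
        _ = _ := by ring
  rw [integral_zero] at hlim
  have hcos : ∀ s : ℝ, 0 < s → ∫ w : ℂ, Real.cos (s * w.re) ∂μ = Real.exp (-(s ^ α)) := by
    intro s hs
    have h1 := congrArg Complex.re (hμ (s : ℂ))
    rw [Complex.norm_real, Real.norm_eq_abs, abs_of_pos hs, ← Complex.ofReal_exp,
      Complex.ofReal_re, charFun_apply, ← RCLike.re_eq_complex_re, ← integral_re] at h1
    · rw [← h1]
      refine integral_congr_ae (.of_forall fun w => ?_)
      simp only [RCLike.re_eq_complex_re, Complex.exp_ofReal_mul_I_re, Complex.inner]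
      simp [mul_comm]
    · refine Integrable.of_bound (by fun_prop) 1 (.of_forall fun w => ?_)
      rw [Complex.norm_exp_ofReal_mul_I]
  have hlow : ∀ n, 1 / 2 ≤ ∫ w, f n w ∂μ := by
    intro n
    have hp : 0 < t n ^ α := Real.rpow_pos_of_pos (ht0 n) _
    have hp1 : t n ^ α ≤ 1 := Real.rpow_le_one (ht0 n).le (ht1 n) hα0.le
    have hi : Integrable (fun w : ℂ => Real.cos (t n * w.re)) μ :=
      Integrable.of_bound (by fun_prop) 1 (.of_forall fun w => by
        rw [Real.norm_eq_abs]; exact Real.abs_cos_le_one _)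
    simp only [f]
    rw [integral_div, integral_sub (integrable_const 1) hi, hcos _ (ht0 n), le_div_iff₀ hp]
    simp only [integral_const, probReal_univ, smul_eq_mul, mul_one]
    set x := t n ^ α
    have h1 : Real.exp (-x) ≤ 1 / (1 + x) := by
      rw [Real.exp_neg, ← one_div]
      exact one_div_le_one_div_of_le (by linarith) (by linarith [Real.add_one_le_exp x])
    have h2 : 1 / (1 + x) ≤ 1 - 1 / 2 * x := by
      rw [div_le_iff₀ (by linarith)]
      nlinarith
    linarith
  have := ge_of_tendsto' hlim hlow
  norm_num at this

lemma ofReal_le_tsum_indicator (y : ℝ) :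
    ENNReal.ofReal y ≤ ∑' j : ℕ, if (j : ℝ) ≤ y then 1 else 0 := by
  rcases lt_or_ge y 0 with h | h
  · simp [ENNReal.ofReal_of_nonpos h.le]
  · calc ENNReal.ofReal y ≤ ENNReal.ofReal ((⌊y⌋₊ + 1 : ℕ) : ℝ) :=
        ENNReal.ofReal_le_ofReal (by push_cast; exact (Nat.lt_floor_add_one y).le)
      _ = ∑ j ∈ Finset.range (⌊y⌋₊ + 1), (1 : ℝ≥0∞) := by
        rw [ENNReal.ofReal_natCast, Finset.sum_const, Finset.card_range, nsmul_one]
      _ = ∑ j ∈ Finset.range (⌊y⌋₊ + 1), if (j : ℝ) ≤ y then (1 : ℝ≥0∞) else 0 := by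
        refine Finset.sum_congr rfl fun j hj => ?_
        rw [if_pos]
        exact (Nat.le_floor_iff h).1 (Nat.lt_succ_iff.1 (Finset.mem_range.1 hj))
      _ ≤ _ := ENNReal.sum_le_tsum _

/-- The number of naturals `j ≤ y` is at least `y`; integrating this at `y = ‖w‖ ^ α / K` bounds the
infinite moment by the sum of tails. -/
lemma tsum_measure_le_norm_rpow_eq_top {α : ℝ} {μ : Measure ℂ}
    (hμ : ∫⁻ w, ENNReal.ofReal (‖w‖ ^ α) ∂μ = ⊤) {K : ℝ} (hK : 0 < K) :
    ∑' j : ℕ, μ {w | K * j ≤ ‖w‖ ^ α} = ⊤ := by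
  have hset : ∀ j : ℕ, MeasurableSet {w : ℂ | K * j ≤ ‖w‖ ^ α} := fun j =>
    measurableSet_le measurable_const (by fun_prop)
  have h1 : ∫⁻ w, ENNReal.ofReal (‖w‖ ^ α / K) ∂μ = ⊤ := by
    simp_rw [div_eq_mul_inv, ENNReal.ofReal_mul' (inv_nonneg.2 hK.le)]
    rw [lintegral_mul_const _ (by fun_prop), hμ, ENNReal.top_mul]
    simpa using hK
  rw [eq_top_iff, ← h1]
  calc ∫⁻ w, ENNReal.ofReal (‖w‖ ^ α / K) ∂μ
      ≤ ∫⁻ w, ∑' j : ℕ, ({w | K * j ≤ ‖w‖ ^ α} : Set ℂ).indicator 1 w ∂μ := by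
        refine lintegral_mono fun w => (ofReal_le_tsum_indicator _).trans (le_of_eq ?_)
        refine tsum_congr fun j => ?_
        simp only [Set.indicator, Set.mem_ofPred_eq, le_div_iff₀ hK, mul_comm, Pi.one_apply]
    _ = ∑' j : ℕ, μ {w | K * j ≤ ‖w‖ ^ α} := by
        rw [lintegral_tsum fun j => (measurable_one.indicator (hset j)).aemeasurable]
        exact tsum_congr fun j => lintegral_indicator_one (hset j)

/-! ### Anti-concentration and the small ball estimate. -/

/-- Anti-concentration: a large variable `W` that is rotation invariant given `Y` is unlikely to be
nearly cancelled by a function of `Y`. -/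
lemma card_mul_measure_le_of_rotation_invariant {Ω β : Type*} [MeasurableSpace Ω]
    [MeasurableSpace β] {P : Measure Ω} {m : ℕ} {ζ : Fin m → ℂ} {K : ℝ}
    (hζK : ∀ (w : ℂ) (r b : ℝ), 0 < b → K * b ≤ ‖w‖ →
      (Finset.univ.filter fun l => |(ζ l * w).re + r| ≤ b).card ≤ 2)
    (hζ : ∀ l, ‖ζ l‖ = 1) {Y : Ω → β} {W : Ω → ℂ} (hY : Measurable Y) (hW : Measurable W)
    (hrot : ∀ l, P.map (fun ω => (Y ω, ζ l * W ω)) = P.map (fun ω => (Y ω, W ω)))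
    {C : Set β} (hC : MeasurableSet C) {r : β → ℝ} (hr : Measurable r) {b : ℝ} (hb : 0 < b) :
    m * P {ω | Y ω ∈ C ∧ K * b ≤ ‖W ω‖ ∧ |(W ω).re + r (Y ω)| ≤ b}
      ≤ 2 * P {ω | Y ω ∈ C ∧ K * b ≤ ‖W ω‖} := by
  have hset : MeasurableSet {p : β × ℂ | p.1 ∈ C ∧ K * b ≤ ‖p.2‖ ∧ |p.2.re + r p.1| ≤ b} :=
    (measurable_fst hC).inter
      ((measurableSet_le (f := fun _ : β × ℂ => K * b) (g := fun p => ‖p.2‖)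
        measurable_const (by fun_prop)).inter
      (measurableSet_le (f := fun p : β × ℂ => |p.2.re + r p.1|) (g := fun _ => b)
        (by fun_prop) measurable_const))
  -- All `m` rotated events have the same probability, so their sum is an expected number of phases,
  -- at most two on the event that `W` is large.
  have h1 : ∀ l, P {ω | Y ω ∈ C ∧ K * b ≤ ‖W ω‖ ∧ |(W ω).re + r (Y ω)| ≤ b}
      = P {ω | Y ω ∈ C ∧ K * b ≤ ‖W ω‖ ∧ |(ζ l * W ω).re + r (Y ω)| ≤ b} := by
    intro l
    have h2 := congrArg (fun μ => μ {p : β × ℂ | p.1 ∈ C ∧ K * b ≤ ‖p.2‖ ∧ |p.2.re + r p.1| ≤ b})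
      (hrot l)
    rw [Measure.map_apply (by fun_prop) hset, Measure.map_apply (by fun_prop) hset] at h2
    simp only [Set.preimage, Set.mem_ofPred_eq, norm_mul, hζ, one_mul] at h2
    exact h2.symm
  have hT : MeasurableSet {ω | Y ω ∈ C ∧ K * b ≤ ‖W ω‖} :=
    (hY hC).inter (measurableSet_le measurable_const hW.norm)
  have hE : ∀ l, MeasurableSet {ω | Y ω ∈ C ∧ K * b ≤ ‖W ω‖ ∧ |(ζ l * W ω).re + r (Y ω)| ≤ b} :=
    fun l => (hY hC).inter ((measurableSet_le measurable_const hW.norm).inter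
      (measurableSet_le (f := fun ω => |(ζ l * W ω).re + r (Y ω)|) (by fun_prop)
        measurable_const))
  calc m * P {ω | Y ω ∈ C ∧ K * b ≤ ‖W ω‖ ∧ |(W ω).re + r (Y ω)| ≤ b}
      = ∑ l : Fin m, P {ω | Y ω ∈ C ∧ K * b ≤ ‖W ω‖ ∧ |(ζ l * W ω).re + r (Y ω)| ≤ b} := by
        rw [← Finset.sum_congr rfl fun l _ => h1 l]
        simp
    _ = ∫⁻ ω, ∑ l : Fin m, ({ω | Y ω ∈ C ∧ K * b ≤ ‖W ω‖ ∧
          |(ζ l * W ω).re + r (Y ω)| ≤ b} : Set Ω).indicator 1 ω ∂P := by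
        rw [lintegral_finsetSum _ fun l _ => measurable_one.indicator (hE l)]
        exact Finset.sum_congr rfl fun l _ => (lintegral_indicator_one (hE l)).symm
    _ ≤ ∫⁻ ω, 2 * ({ω | Y ω ∈ C ∧ K * b ≤ ‖W ω‖} : Set Ω).indicator 1 ω ∂P := by
        refine lintegral_mono fun ω => ?_
        by_cases hω : Y ω ∈ C ∧ K * b ≤ ‖W ω‖
        · have := hζK (W ω) (r (Y ω)) b hb hω.2
          simp only [Set.indicator, Set.mem_ofPred_eq, hω, true_and, and_self, if_true,
            Pi.one_apply, mul_one, Finset.sum_boole]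
          exact_mod_cast this
        · rw [Finset.sum_eq_zero]
          · exact zero_le
          · intro l _
            refine Set.indicator_of_notMem (fun h => hω ⟨h.1, h.2.1⟩) _
    _ = _ := by
        rw [lintegral_const_mul _ (measurable_one.indicator hT), lintegral_indicator_one hT]

namespace IsIsotropicStableRandomMeasure

variable {Ω : Type*} [MeasurableSpace Ω] {P : Measure Ω} {α : ℝ} {M : Set ℝ → Ω → ℂ}

/-- Since `g` lives where every `F k` vanishes, rotating `g` alone preserves the modulus of every
linear combination, hence the joint law. The `F k` may overlap one another. -/
lemma map_integral_rotate_eq (hM : IsIsotropicStableRandomMeasure P α M)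
    [IsProbabilityMeasure P] (hα : 0 < α) {κ : Type*} [Fintype κ] {F : κ → SimpleFunc ℝ ℂ}
    {g : SimpleFunc ℝ ℂ} (hF : ∀ k, (F k).FinMeasSupp volume) (hg : g.FinMeasSupp volume)
    (hd : ∀ ξ, g ξ = 0 ∨ ∀ k, F k ξ = 0) {ζ : ℂ} (hζ : ‖ζ‖ = 1) :
    P.map (fun ω => ((fun k => simpleStochasticIntegral M (F k) ω),
        ζ * simpleStochasticIntegral M g ω))
      = P.map (fun ω => ((fun k => simpleStochasticIntegral M (F k) ω),
        simpleStochasticIntegral M g ω)) := by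
  let G : SimpleFunc ℝ ℂ → Option κ → SimpleFunc ℝ ℂ := fun h o => o.elim h F
  have hG : ∀ h : SimpleFunc ℝ ℂ, h.FinMeasSupp volume →
      ∀ o, (G h o).FinMeasSupp volume := by
    rintro h hh (_ | k)
    exacts [hh, hF k]
  have hζg := SimpleFunc.finMeasSupp_const_mul hg ζ
  have key := hM.map_integral_vector_eq hα (hG _ hζg) (hG _ hg) (fun z ξ => by
    simp only [Fintype.sum_option, G, Option.elim_none, Option.elim_some]
    rcases hd ξ with h | h
    · simp [h]
    · simp only [h, mul_zero, Finset.sum_const_zero, add_zero, norm_mul, SimpleFunc.coe_mul,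
        SimpleFunc.coe_const, Pi.mul_apply, Function.const_apply, hζ, one_mul])
  have hmeas : ∀ h : SimpleFunc ℝ ℂ, h.FinMeasSupp volume →
      Measurable fun ω o => simpleStochasticIntegral M (G h o) ω := fun h hh =>
    measurable_pi_lambda _ fun o => hM.measurable_integral (hG h hh o)
  have hφ : Measurable fun x : Option κ → ℂ => ((fun k => x (some k)), x none) := by fun_prop
  have := congrArg (Measure.map fun x : Option κ → ℂ => ((fun k => x (some k)), x none)) key
  rw [Measure.map_map hφ (hmeas _ hζg), Measure.map_map hφ (hmeas _ hg)] at this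
  refine (Measure.map_congr ?_).trans this
  filter_upwards [hM.integral_const_mul_ae hg ζ] with ω hω
  simp only [Function.comp_apply, G, Option.elim_none, Option.elim_some, hω]

/-- The main small ball estimate for finitely many integrals, in terms of the parts of their
integrands on disjoint sets. -/
lemma measure_forall_abs_re_le (hM : IsIsotropicStableRandomMeasure P α M)
    [IsProbabilityMeasure P] (hα : 0 < α) {m : ℕ} (hm : 0 < m) {ζ : Fin m → ℂ} {K : ℝ}
    (hζK : ∀ (w : ℂ) (r b : ℝ), 0 < b → K * b ≤ ‖w‖ →
      (Finset.univ.filter fun l => |(ζ l * w).re + r| ≤ b).card ≤ 2)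
    (hζ : ∀ l, ‖ζ l‖ = 1) {ι : Type*} [Fintype ι] [LinearOrder ι] {f : ι → SimpleFunc ℝ ℂ}
    (hf : ∀ i, (f i).FinMeasSupp volume) {B : ι → Set ℝ} (hB : ∀ i, MeasurableSet (B i))
    (hBd : Pairwise (Function.onFun Disjoint B)) {b : ι → ℝ} (hb : ∀ i, 0 < b i) :
    P {ω | ∀ i, |(simpleStochasticIntegral M (f i) ω).re| ≤ b i}
      ≤ 2 / m + ∏ i, P {ω | ‖simpleStochasticIntegral M ((f i).restrict (B i)) ω‖ < K * b i} := by
  classical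
  set W : ι → Ω → ℂ := fun i => simpleStochasticIntegral M ((f i).restrict (B i)) with hWdef
  set R : ι → Ω → ℂ := fun i => simpleStochasticIntegral M ((f i).restrict (B i)ᶜ) with hRdef
  have hWf : ∀ i, ((f i).restrict (B i)).FinMeasSupp volume := fun i =>
    SimpleFunc.finMeasSupp_restrict (hf i) (hB i)
  have hRf : ∀ i, ((f i).restrict (B i)ᶜ).FinMeasSupp volume := fun i =>
    SimpleFunc.finMeasSupp_restrict (hf i) (hB i).compl
  have hWm : ∀ i, Measurable (W i) := fun i => hM.measurable_integral (hWf i)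
  have hRm : ∀ i, Measurable (R i) := fun i => hM.measurable_integral (hRf i)
  have hrestr : ∀ i ξ, ξ ∉ B i → (f i).restrict (B i) ξ = 0 := fun i ξ h => by
    rw [SimpleFunc.restrict_apply _ (hB i), Set.indicator_of_notMem h]
  have hsplit : ∀ᵐ ω ∂P, ∀ i, simpleStochasticIntegral M (f i) ω = W i ω + R i ω := by
    refine ae_all_iff.2 fun i => ?_
    have h1 : f i = (f i).restrict (B i) + (f i).restrict (B i)ᶜ := by
      ext ξ
      rw [SimpleFunc.add_apply, SimpleFunc.restrict_apply _ (hB i),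
        SimpleFunc.restrict_apply _ (hB i).compl, Set.indicator_self_add_compl_apply]
    filter_upwards [hM.integral_add_ae (hWf i) (hRf i)] with ω hω
    rw [← hω, ← h1]
  -- `j` is the first index with a large band part; these events are disjoint, so the costs `2 / m *
  -- P (T j)` add up to at most `2 / m`.
  let T : ι → Set Ω := fun j => {ω | (∀ i, i < j → ‖W i ω‖ < K * b i) ∧ K * b j ≤ ‖W j ω‖}
  have hTm : ∀ j, MeasurableSet (T j) := by
    intro j
    simp only [T, Set.ofPred_and, Set.ofPred_forall]
    exact (MeasurableSet.iInter fun i => MeasurableSet.iInter fun _ =>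
      measurableSet_lt (hWm i).norm measurable_const).inter
        (measurableSet_le measurable_const (hWm j).norm)
  have hone : ∀ j, P (T j ∩ {ω | |(W j ω + R j ω).re| ≤ b j}) ≤ 2 / m * P (T j) := by
    intro j
    -- The data held fixed while `W j` is rotated: `none` carries the remainder `R j`, `some i` an
    -- earlier band part. All integrands vanish on `B j`.
    let F : Option {i // i < j} → SimpleFunc ℝ ℂ := fun o =>
      o.elim ((f j).restrict (B j)ᶜ) fun i => (f i).restrict (B i)
    have hF : ∀ o, (F o).FinMeasSupp volume := by
      rintro (_ | i)
      exacts [hRf j, hWf i]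
    have hd : ∀ ξ, (f j).restrict (B j) ξ = 0 ∨ ∀ k, F k ξ = 0 := by
      intro ξ
      by_cases hξ : ξ ∈ B j
      · right
        rintro (_ | i)
        · simp only [F, Option.elim_none]
          rw [SimpleFunc.restrict_apply _ (hB j).compl, Set.indicator_of_notMem (by simpa using hξ)]
        · exact hrestr i ξ fun h => Set.disjoint_left.1 (hBd i.2.ne) h hξ
      · exact .inl (hrestr j ξ hξ)
    let C : Set (Option {i // i < j} → ℂ) := {y | ∀ i : {i // i < j}, ‖y (some i)‖ < K * b i}
    have hC : MeasurableSet C := by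
      simp only [C, Set.ofPred_forall]
      exact MeasurableSet.iInter fun i => measurableSet_lt (by fun_prop) measurable_const
    have h := card_mul_measure_le_of_rotation_invariant hζK hζ
      (Y := fun ω k => simpleStochasticIntegral M (F k) ω)
      (measurable_pi_lambda _ fun k => hM.measurable_integral (hF k)) (hWm j)
      (fun l => hM.map_integral_rotate_eq hα hF (hWf j) hd (hζ l)) hC
      (r := fun y => (y none).re) (by fun_prop) (hb j)
    have e1 : {ω | (fun k => simpleStochasticIntegral M (F k) ω) ∈ C ∧ K * b j ≤ ‖W j ω‖} = T j := by
      ext ω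
      simp [C, T, F, W]
    have e2 : {ω | (fun k => simpleStochasticIntegral M (F k) ω) ∈ C ∧ K * b j ≤ ‖W j ω‖ ∧
        |(W j ω).re + (simpleStochasticIntegral M (F none) ω).re| ≤ b j}
        = T j ∩ {ω | |(W j ω + R j ω).re| ≤ b j} := by
      ext ω
      simp [C, T, F, W, R, and_assoc]
    rw [e1, e2] at h
    rw [div_eq_mul_inv, mul_assoc, mul_comm (_⁻¹), ← mul_assoc, ← div_eq_mul_inv,
      ENNReal.le_div_iff_mul_le (.inl (by simpa using hm.ne')) (.inl (by simp)), mul_comm]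
    exact h
  have hTd : Pairwise (Function.onFun Disjoint T) := by
    have h : ∀ i j, i < j → Disjoint (T i) (T j) := fun i j hij =>
      Set.disjoint_left.2 fun ω hi hj => absurd (hj.1 i hij) (not_lt.2 hi.2)
    intro i j hij
    rcases lt_or_gt_of_ne hij with h' | h'
    exacts [h i j h', (h j i h').symm]
  have hind : P {ω | ∀ i, ‖W i ω‖ < K * b i} = ∏ i, P {ω | ‖W i ω‖ < K * b i} := by
    have h1 := hM.iIndepFun_integral hα hWf fun i j hij ξ => by
      by_cases h : ξ ∈ B i
      · exact .inr (hrestr j ξ fun h' => Set.disjoint_left.1 (hBd hij) h h')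
      · exact .inl (hrestr i ξ h)
    have h2 := h1.measure_inter_preimage_eq_mul Finset.univ
      (sets := fun i => {w : ℂ | ‖w‖ < K * b i})
      (fun i _ => measurableSet_lt (by fun_prop) measurable_const)
    rw [← show _ = ∏ i, P {ω | ‖W i ω‖ < K * b i} from h2]
    congr 1
    ext ω
    simp [W]
  have hsub : ∀ᵐ ω ∂P, ω ∈ {ω | ∀ i, |(simpleStochasticIntegral M (f i) ω).re| ≤ b i} →
      ω ∈ (⋃ j, T j ∩ {ω | |(W j ω + R j ω).re| ≤ b j}) ∪ {ω | ∀ i, ‖W i ω‖ < K * b i} := by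
    filter_upwards [hsplit] with ω hω h
    by_cases hall : ∀ i, ‖W i ω‖ < K * b i
    · exact .inr hall
    · left
      push Not at hall
      obtain ⟨j, hj, hmin⟩ := (Finset.univ.filter fun i => K * b i ≤ ‖W i ω‖).exists_minimal
        (by obtain ⟨i, hi⟩ := hall; exact ⟨i, by simpa using hi⟩)
      refine Set.mem_iUnion.2 ⟨j, ⟨fun i hij => ?_, by simpa using hj⟩, ?_⟩
      · by_contra hi
        exact absurd (hmin (by simpa using hi) hij.le) (not_le.2 hij)
      · simp only [Set.mem_ofPred_eq]
        rw [← hω j]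
        exact h j
  calc P {ω | ∀ i, |(simpleStochasticIntegral M (f i) ω).re| ≤ b i}
      ≤ P ((⋃ j, T j ∩ {ω | |(W j ω + R j ω).re| ≤ b j}) ∪ {ω | ∀ i, ‖W i ω‖ < K * b i}) :=
        measure_mono_ae hsub
    _ ≤ P (⋃ j, T j ∩ {ω | |(W j ω + R j ω).re| ≤ b j}) + P {ω | ∀ i, ‖W i ω‖ < K * b i} :=
        measure_union_le _ _
    _ ≤ ∑ j, 2 / m * P (T j) + ∏ i, P {ω | ‖W i ω‖ < K * b i} := by
        rw [hind]
        gcongr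
        exact (measure_iUnion_fintype_le _ _).trans (Finset.sum_le_sum fun j _ => hone j)
    _ ≤ 2 / m + ∏ i, P {ω | ‖W i ω‖ < K * b i} := by
        rw [← Finset.mul_sum]
        gcongr
        refine mul_le_of_le_one_right zero_le ?_
        rw [← measure_biUnion_finset (fun i _ j _ hij => hTd hij) fun j _ => hTm j]
        exact prob_le_one

end IsIsotropicStableRandomMeasure

/-! ### Analytic estimates: products, frequency bands, scales. -/

/-- A quasi-triangle inequality that treats `α < 1` and `α ≥ 1` alike. -/
lemma enorm_add_rpow_le {α : ℝ} (hα : 0 ≤ α) (x y : ℂ) :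
    ‖x + y‖ₑ ^ α ≤ 2 ^ α * (‖x‖ₑ ^ α + ‖y‖ₑ ^ α) := by
  have h1 : ‖x + y‖ₑ ≤ 2 * max ‖x‖ₑ ‖y‖ₑ := by
    refine (enorm_add_le _ _).trans ?_
    rw [two_mul]
    exact add_le_add (le_max_left _ _) (le_max_right _ _)
  refine (ENNReal.rpow_le_rpow h1 hα).trans ?_
  rw [ENNReal.mul_rpow_of_nonneg _ _ hα]
  gcongr
  rcases le_total ‖x‖ₑ ‖y‖ₑ with h | h
  · rw [max_eq_right h]; exact le_add_self
  · rw [max_eq_left h]; exact le_self_add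

lemma tendsto_lintegral_of_tendsto_eLpNorm {α : ℝ} (hα : 0 < α) {f : ℕ → ℝ → ℂ}
    (h : Tendsto (fun n => eLpNorm (f n) (ENNReal.ofReal α) volume) atTop (𝓝 0)) :
    Tendsto (fun n => ∫⁻ ξ, ‖f n ξ‖ₑ ^ α) atTop (𝓝 0) := by
  have h1 := h.ennrpow_const α
  rw [ENNReal.zero_rpow_of_pos hα] at h1
  refine h1.congr fun n => ?_
  rw [eLpNorm_eq_lintegral_rpow_enorm_toReal (by simpa using hα) (by simp),
    ENNReal.toReal_ofReal hα.le, ← ENNReal.rpow_mul, one_div_mul_cancel hα.ne', ENNReal.rpow_one]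

/-- The estimate behind the second Borel–Cantelli lemma: `1 - x ≤ exp (-x)` and the sum diverges. -/
lemma prod_measure_compl_tendsto_zero {β : Type*} [MeasurableSpace β] {μ : Measure β}
    [IsProbabilityMeasure μ] {s : ℕ → Set β} (hs : ∀ j, MeasurableSet (s j))
    (hsum : ∑' j, μ (s j) = ⊤) :
    Tendsto (fun N => ∏ i : Fin N, μ (s i)ᶜ) atTop (𝓝 0) := by
  have hle : ∀ N, ∏ i : Fin N, μ (s i)ᶜ
      ≤ ENNReal.ofReal (Real.exp (-∑ i ∈ Finset.range N, μ.real (s i))) := by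
    intro N
    rw [Fin.prod_univ_eq_prod_range (fun i => μ (s i)ᶜ) N, ← Finset.sum_neg_distrib, Real.exp_sum,
      ENNReal.ofReal_prod_of_nonneg fun _ _ => (Real.exp_pos _).le]
    refine Finset.prod_le_prod' fun i _ => ?_
    rw [← ofReal_measureReal, probReal_compl_eq_one_sub (hs i)]
    exact ENNReal.ofReal_le_ofReal (by linarith [Real.add_one_le_exp (-μ.real (s i))])
  have hns : ¬ Summable fun j => μ.real (s j) := by
    intro h
    have h1 := h.tsum_ofReal_ne_top
    exact h1 (by rw [← hsum]; exact tsum_congr fun j => ofReal_measureReal)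
  have h1 := (not_summable_iff_tendsto_nat_atTop_of_nonneg fun j => measureReal_nonneg).1 hns
  have h2 := ENNReal.tendsto_ofReal
    (Real.tendsto_exp_atBot.comp (tendsto_neg_atTop_atBot.comp h1))
  rw [ENNReal.ofReal_zero] at h2
  exact tendsto_of_tendsto_of_tendsto_of_le_of_le tendsto_const_nhds h2 (fun _ => zero_le) hle

lemma one_sub_cos_one_le_norm_exp_sub_one {η : ℝ} (h1 : 1 ≤ η) (h2 : η ≤ 2) :
    1 - Real.cos 1 ≤ ‖Complex.exp (Complex.I * η) - 1‖ := by
  have hc : Real.cos η ≤ Real.cos 1 :=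
    Real.cos_le_cos_of_nonneg_of_le_pi zero_le_one (by linarith [Real.pi_gt_three]) h1
  have := Complex.abs_re_le_norm (Complex.exp (Complex.I * η) - 1)
  rw [Complex.sub_re, mul_comm, Complex.exp_ofReal_mul_I_re, Complex.one_re] at this
  rw [mul_comm]
  linarith [neg_le_abs (Real.cos η - 1)]

/-- On the frequency band `[2 ^ j, 2 ^ (j + 1))` the kernel of the increment of lag `2 ^ (-j)` has
`α`-th moment at least of order `2 ^ (-j H α)`. -/
lemma exists_le_lintegral_band {H α : ℝ} (hH : 0 < H) (hα : 0 < α) :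
    ∃ κ : ℝ, 0 < κ ∧ ∀ (u : ℝ) (j : ℕ),
      ENNReal.ofReal (κ * (((2 : ℝ) ^ j)⁻¹ ^ H) ^ α) ≤
        ∫⁻ ξ in Set.Ico ((2 : ℝ) ^ j) (2 ^ (j + 1)),
          ‖hfsmKernel H α (u + ((2 : ℝ) ^ j)⁻¹) ξ - hfsmKernel H α u ξ‖ₑ ^ α := by
  have hc : 0 < 1 - Real.cos 1 := by linarith [Real.cos_one_le]
  have h2p : (0 : ℝ) < 2 ^ (H + 1 / α) := by positivity
  -- With `q = 2 ^ j`, the ratio `ξ / q` lies in `[1, 2)`, so the numerator is at least `1 - cos 1`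
  -- and the denominator at most `(2 * q) ^ (H + 1 / α)`. The band length `q` absorbs the exponent
  -- `1 / α`.
  refine ⟨((1 - Real.cos 1) / 2 ^ (H + 1 / α)) ^ α, by positivity, fun u j => ?_⟩
  set q : ℝ := 2 ^ j with hq
  have hq0 : 0 < q := by positivity
  have hpt : ∀ ξ ∈ Set.Ico q (2 ^ (j + 1)),
      ENNReal.ofReal (((1 - Real.cos 1) / (2 * q) ^ (H + 1 / α)) ^ α)
        ≤ ‖hfsmKernel H α (u + q⁻¹) ξ - hfsmKernel H α u ξ‖ₑ ^ α := by
    intro ξ hξ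
    rw [pow_succ, ← hq, mul_comm] at hξ
    have hξ0 : 0 < ξ := hq0.trans_le hξ.1
    have e : hfsmKernel H α (u + q⁻¹) ξ - hfsmKernel H α u ξ
        = Complex.exp ((u * ξ : ℝ) * Complex.I) * (Complex.exp (Complex.I * (q⁻¹ * ξ : ℝ)) - 1)
          / ((|ξ| ^ (H + 1 / α) : ℝ) : ℂ) := by
      unfold hfsmKernel
      rw [← sub_div, mul_sub, ← Complex.exp_add]
      congr 1
      push_cast
      ring_nf
    rw [← ofReal_norm, ENNReal.ofReal_rpow_of_nonneg (norm_nonneg _) hα.le]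
    apply ENNReal.ofReal_le_ofReal
    apply Real.rpow_le_rpow (by positivity) _ hα.le
    rw [e, norm_div, norm_mul, Complex.norm_exp_ofReal_mul_I, one_mul, Complex.norm_real,
      Real.norm_of_nonneg (by positivity), abs_of_pos hξ0]
    have hη : q⁻¹ * ξ = ξ / q := by rw [div_eq_mul_inv, mul_comm]
    have := one_sub_cos_one_le_norm_exp_sub_one (η := q⁻¹ * ξ)
      (by rw [hη, le_div_iff₀ hq0]; linarith [hξ.1])
      (by rw [hη, div_le_iff₀ hq0]; exact hξ.2.le)
    gcongr
    exact hξ.2.le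
  calc ENNReal.ofReal (((1 - Real.cos 1) / 2 ^ (H + 1 / α)) ^ α * (q⁻¹ ^ H) ^ α)
      = ENNReal.ofReal (((1 - Real.cos 1) / (2 * q) ^ (H + 1 / α)) ^ α)
          * volume (Set.Ico q (2 ^ (j + 1))) := by
        have h1 : (2 : ℝ) ^ (j + 1) - q = q := by rw [pow_succ, ← hq]; ring
        rw [Real.volume_Ico, h1, ← ENNReal.ofReal_mul (by positivity)]
        congr 1
        have h2 : (q ^ (1 / α)) ^ α = q := by
          rw [← Real.rpow_mul hq0.le, one_div_mul_cancel hα.ne', Real.rpow_one]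
        rw [Real.mul_rpow (by norm_num) hq0.le, Real.rpow_add hq0, ← Real.mul_rpow (by positivity)
          (by positivity)]
        calc _ = (((1 - Real.cos 1) / (2 ^ (H + 1 / α) * (q ^ H * q ^ (1 / α))))
              * q ^ (1 / α)) ^ α := by
              rw [Real.inv_rpow hq0.le]
              congr 1
              field_simp
          _ = _ := by rw [Real.mul_rpow (by positivity) (by positivity), h2]
    _ = ∫⁻ ξ in Set.Ico q (2 ^ (j + 1)),
          ENNReal.ofReal (((1 - Real.cos 1) / (2 * q) ^ (H + 1 / α)) ^ α) := by
        rw [setLIntegral_const]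
    _ ≤ _ := setLIntegral_mono' measurableSet_Ico hpt

namespace IsIsotropicStableRandomMeasure

variable {Ω : Type*} [MeasurableSpace Ω] {P : Measure Ω} {α : ℝ} {M : Set ℝ → Ω → ℂ}

/-- The integral has the law of `σ ^ (1 / α) * M [0, 1]`; replacing the scale `σ` by a smaller `s`
only enlarges the event. -/
lemma measure_norm_integral_lt_le (hM : IsIsotropicStableRandomMeasure P α M)
    [IsProbabilityMeasure P] (hα : 0 < α) {f : SimpleFunc ℝ ℂ} (hf : f.FinMeasSupp volume)
    {s t : ℝ} (hs : s ≤ stableScale α f) :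
    P {ω | ‖simpleStochasticIntegral M f ω‖ < t}
      ≤ P {ω | s * ‖M (Set.Icc 0 1) ω‖ ^ α < t ^ α} := by
  set σ := stableScale α f with hσ
  have hσ0 : 0 ≤ σ := ENNReal.toReal_nonneg
  have hvol : (volume (Set.Icc (0 : ℝ) 1)) = 1 := by simp
  have hMm : Measurable (M (Set.Icc 0 1)) := hM.measurable _ measurableSet_Icc (by simp)
  have hIm := hM.measurable_integral hf
  have hlaw : P.map (simpleStochasticIntegral M f)
      = P.map fun ω => ((σ ^ (1 / α) : ℝ) : ℂ) * M (Set.Icc 0 1) ω := by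
    have : IsProbabilityMeasure (P.map (simpleStochasticIntegral M f)) :=
      Measure.isProbabilityMeasure_map hIm.aemeasurable
    have : IsProbabilityMeasure (P.map fun ω => ((σ ^ (1 / α) : ℝ) : ℂ) * M (Set.Icc 0 1) ω) :=
      Measure.isProbabilityMeasure_map (hMm.const_mul _).aemeasurable
    refine Measure.ext_of_charFun ?_
    ext z
    rw [hM.charFun_integral hα hf, charFun_map_const_mul hMm.aemeasurable,
      hM.charFun_eq _ measurableSet_Icc (by simp), hvol, ENNReal.toReal_one, one_mul, norm_mul,
      RCLike.norm_conj, Complex.norm_real, Real.norm_of_nonneg (by positivity),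
      Real.mul_rpow (by positivity) (norm_nonneg _), ← Real.rpow_mul hσ0,
      one_div_mul_cancel hα.ne', Real.rpow_one]
  have hset : MeasurableSet {w : ℂ | ‖w‖ < t} := measurableSet_lt (by fun_prop) measurable_const
  have h1 := congrArg (fun μ : Measure ℂ => μ {w : ℂ | ‖w‖ < t}) hlaw
  rw [Measure.map_apply hIm hset, Measure.map_apply (hMm.const_mul _) hset] at h1
  refine (le_of_eq h1).trans (measure_mono fun ω hω => ?_)
  simp only [Set.preimage, Set.mem_ofPred_eq, norm_mul, Complex.norm_real] at hω ⊢
  rw [Real.norm_of_nonneg (by positivity)] at hω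
  have h2 := Real.rpow_lt_rpow (by positivity) hω hα
  rw [Real.mul_rpow (by positivity) (norm_nonneg _), ← Real.rpow_mul hσ0,
    one_div_mul_cancel hα.ne', Real.rpow_one] at h2
  exact lt_of_le_of_lt (by gcongr) h2

lemma tsum_measure_eq_top (hM : IsIsotropicStableRandomMeasure P α M)
    [IsProbabilityMeasure P] (hα0 : 0 < α) (hα2 : α < 2) {K : ℝ} (hK : 0 < K) :
    ∑' j : ℕ, P {ω | K * j ≤ ‖M (Set.Icc 0 1) ω‖ ^ α} = ⊤ := by
  have hMm : Measurable (M (Set.Icc 0 1)) := hM.measurable _ measurableSet_Icc (by simp)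
  have : IsProbabilityMeasure (P.map (M (Set.Icc 0 1))) :=
    Measure.isProbabilityMeasure_map hMm.aemeasurable
  have h1 := tsum_measure_le_norm_rpow_eq_top (lintegral_norm_rpow_eq_top_of_charFun hα0 hα2
    (μ := P.map (M (Set.Icc 0 1))) fun z => by
      rw [hM.charFun_eq _ measurableSet_Icc (by simp)]; simp) hK
  rw [← h1]
  refine tsum_congr fun j => ?_
  rw [Measure.map_apply hMm (measurableSet_le measurable_const (by fun_prop))]
  rfl

end IsIsotropicStableRandomMeasure

/-- Approximation in `L^α` keeps the band mass: by the quasi-triangle inequality the mass of `f`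
plus the error is at least `L / 2 ^ α`, and the error may use half of that. -/
lemma le_stableScale_restrict {α : ℝ} (hα : 0 < α) {f : SimpleFunc ℝ ℂ}
    (hf : f.FinMeasSupp volume) {B : Set ℝ} (hB : MeasurableSet B) {g : ℝ → ℂ} {L : ℝ}
    (hL : 0 < L) (hg : ENNReal.ofReal L ≤ ∫⁻ ξ in B, ‖g ξ‖ₑ ^ α)
    (hfg : ∫⁻ ξ, ‖f ξ - g ξ‖ₑ ^ α ≤ ENNReal.ofReal (L / 2 ^ α / 2)) :
    L / 2 ^ α / 2 ≤ stableScale α (f.restrict B) := by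
  have h2 : (2 : ℝ≥0∞) ^ α = ENNReal.ofReal (2 ^ α) := by
    rw [← ENNReal.ofReal_rpow_of_pos two_pos, ENNReal.ofReal_ofNat]
  have hfm : Measurable fun ξ => ‖f ξ‖ₑ ^ α := (f.measurable.enorm).pow_const α
  have e : ∫⁻ ξ, ‖f.restrict B ξ‖ₑ ^ α = ∫⁻ ξ in B, ‖f ξ‖ₑ ^ α := by
    rw [← lintegral_indicator hB]
    refine lintegral_congr fun ξ => ?_
    rw [SimpleFunc.restrict_apply _ hB]
    by_cases h : ξ ∈ B <;> simp [h, hα]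
  have hfin : ∫⁻ ξ in B, ‖f ξ‖ₑ ^ α ≠ ⊤ := by
    have h1 := (hf.map (g := fun c => ‖c‖ₑ ^ α) (by simp [hα])).lintegral_lt_top
      (.of_forall fun ξ => by simp [hα.le])
    rw [← SimpleFunc.lintegral_eq_lintegral] at h1
    exact ((setLIntegral_le_lintegral _ _).trans_lt h1).ne
  have key : ENNReal.ofReal L
      ≤ ENNReal.ofReal (2 ^ α) * ((∫⁻ ξ in B, ‖f ξ‖ₑ ^ α) + ENNReal.ofReal (L / 2 ^ α / 2)) := by
    refine hg.trans ?_
    calc ∫⁻ ξ in B, ‖g ξ‖ₑ ^ α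
        ≤ ∫⁻ ξ in B, 2 ^ α * (‖f ξ‖ₑ ^ α + ‖f ξ - g ξ‖ₑ ^ α) := by
          refine lintegral_mono fun ξ => ?_
          have := enorm_add_rpow_le hα.le (f ξ) (-(f ξ - g ξ))
          rwa [enorm_neg, neg_sub, add_sub_cancel] at this
      _ = 2 ^ α * ((∫⁻ ξ in B, ‖f ξ‖ₑ ^ α) + ∫⁻ ξ in B, ‖f ξ - g ξ‖ₑ ^ α) := by
          rw [lintegral_const_mul' _ _ (by simp), lintegral_add_left hfm]
      _ ≤ _ := by
          rw [h2]
          gcongr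
          exact (setLIntegral_le_lintegral _ _).trans hfg
  unfold stableScale
  rw [e]
  rw [← ENNReal.ofReal_toReal hfin, ← ENNReal.ofReal_add ENNReal.toReal_nonneg (by positivity),
    ← ENNReal.ofReal_mul (by positivity), ENNReal.ofReal_le_ofReal_iff
      (by have := ENNReal.toReal_nonneg (a := ∫⁻ ξ in B, ‖f ξ‖ₑ ^ α); positivity)] at key
  have h2p : (0 : ℝ) < 2 ^ α := by positivity
  rw [mul_comm, ← div_le_iff₀ h2p] at key
  linarith

/-- Makes the thresholds linear in `j`, as in the divergent series `tsum_measure_eq_top`. -/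
lemma log_one_add_two_pow_le {j : ℕ} (hj : 1 ≤ j) : Real.log (1 + 2 ^ j) ≤ 2 * j := by
  have h1 : (1 : ℝ) + 2 ^ j ≤ 2 ^ (j + j) := by
    have : (2 : ℝ) ≤ 2 ^ j := by
      calc (2 : ℝ) = 2 ^ 1 := by norm_num
        _ ≤ 2 ^ j := pow_le_pow_right₀ (by norm_num) hj
    rw [pow_add]
    nlinarith
  calc Real.log (1 + 2 ^ j) ≤ Real.log (2 ^ (j + j)) := Real.log_le_log (by positivity) h1
    _ = (2 * j) * Real.log 2 := by rw [Real.log_pow]; push_cast; ring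
    _ ≤ (2 * j) * 1 := by gcongr; linarith [Real.log_two_lt_d9]
    _ = 2 * j := mul_one _

/-! ### Increments of the process and the conclusion. -/

namespace IsHFSM

variable {Ω : Type*} [MeasurableSpace Ω] {P : Measure Ω} {H α : ℝ} {M : Set ℝ → Ω → ℂ}
  {X : ℝ → Ω → ℝ}

/-- The increments of the process are limits in probability of integrals of simple functions. -/
lemma exists_approx_increment (hX : IsHFSM P H α M X) (hα : 0 < α) (s t : ℝ) :
    ∃ f : ℕ → SimpleFunc ℝ ℂ, (∀ n, (f n).FinMeasSupp volume) ∧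
      Tendsto (fun n => ∫⁻ ξ, ‖f n ξ - (hfsmKernel H α t ξ - hfsmKernel H α s ξ)‖ₑ ^ α)
        atTop (𝓝 0) ∧
      ∀ ε : ℝ, 0 < ε → Tendsto (fun n => P {ω | ε ≤
        |(simpleStochasticIntegral M (f n) ω).re - (X t ω - X s ω)|}) atTop (𝓝 0) := by
  obtain ⟨Y, ⟨_, f, hf, hfL, hfP⟩, hY⟩ := hX.integral_eq t
  obtain ⟨Z, ⟨hZL, g, hg, hgL, hgP⟩, hZ⟩ := hX.integral_eq s
  have hM := hX.randomMeasure
  refine ⟨fun n => f n + SimpleFunc.const ℝ (-1) * g n, fun n =>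
    (hf n).add (SimpleFunc.finMeasSupp_const_mul (hg n) _), ?_, ?_⟩
  · have h1 := tendsto_lintegral_of_tendsto_eLpNorm hα hfL
    have h2 := tendsto_lintegral_of_tendsto_eLpNorm hα hgL
    have h3 := ENNReal.Tendsto.const_mul (a := 2 ^ α) (h1.add h2) (.inr (by simp))
    rw [add_zero, mul_zero] at h3
    refine tendsto_of_tendsto_of_tendsto_of_le_of_le tendsto_const_nhds h3 (fun _ => zero_le)
      fun n => ?_
    have hm : AEMeasurable (fun ξ => ‖g n ξ - hfsmKernel H α s ξ‖ₑ ^ α) volume :=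
      (((g n).measurable.aemeasurable.sub hZL.1.aemeasurable).enorm).pow_const α
    simp only
    rw [← lintegral_add_right' _ hm, ← lintegral_const_mul' _ _ (by simp)]
    refine lintegral_mono fun ξ => ?_
    have := enorm_add_rpow_le hα.le (f n ξ - hfsmKernel H α t ξ) (-(g n ξ - hfsmKernel H α s ξ))
    rw [enorm_neg] at this
    refine le_trans (le_of_eq ?_) this
    congr 2
    simp only [SimpleFunc.coe_add, SimpleFunc.coe_mul, SimpleFunc.coe_const, Pi.add_apply,
      Pi.mul_apply, Function.const_apply]
    ring
  · intro ε hε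
    have hε2 : (0 : ℝ≥0∞) < ENNReal.ofReal (ε / 2) := by simpa using hε
    have h3 := (hfP _ hε2).add (hgP _ hε2)
    rw [add_zero] at h3
    refine tendsto_of_tendsto_of_tendsto_of_le_of_le tendsto_const_nhds h3 (fun _ => zero_le)
      fun n => ?_
    refine (measure_mono_ae ?_).trans (measure_union_le _ _)
    filter_upwards [hM.integral_add_ae (hf n)
      (SimpleFunc.finMeasSupp_const_mul (hg n) (-1)),
      hM.integral_const_mul_ae (hg n) (-1), hY, hZ] with ω h1 h2 h4 h5 h6
    by_contra hcon
    have hcon' : ¬ (ENNReal.ofReal (ε / 2) ≤ edist (simpleStochasticIntegral M (f n) ω) (Y ω)) ∧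
        ¬ (ENNReal.ofReal (ε / 2) ≤ edist (simpleStochasticIntegral M (g n) ω) (Z ω)) :=
      not_or.1 hcon
    rw [edist_dist, edist_dist, ENNReal.ofReal_le_ofReal_iff dist_nonneg,
      ENNReal.ofReal_le_ofReal_iff dist_nonneg, not_le, not_le, dist_eq_norm, dist_eq_norm]
      at hcon'
    have h6' : ε ≤ |(simpleStochasticIntegral M (f n + SimpleFunc.const ℝ (-1) * g n) ω).re
      - (X t ω - X s ω)| := h6
    rw [h1, h2, h4, h5] at h6'
    have h7 := Complex.abs_re_le_norm (simpleStochasticIntegral M (f n) ω - Y ω)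
    have h8 := Complex.abs_re_le_norm (simpleStochasticIntegral M (g n) ω - Z ω)
    rw [Complex.sub_re] at h7 h8
    have h9 := abs_sub ((simpleStochasticIntegral M (f n) ω).re - (Y ω).re)
      ((simpleStochasticIntegral M (g n) ω).re - (Z ω).re)
    simp only [Complex.add_re, neg_mul, one_mul, Complex.neg_re] at h6'
    have h10 : (simpleStochasticIntegral M (f n) ω).re + -(simpleStochasticIntegral M (g n) ω).re
        - ((Y ω).re - (Z ω).re) = ((simpleStochasticIntegral M (f n) ω).re - (Y ω).re)
        - ((simpleStochasticIntegral M (g n) ω).re - (Z ω).re) := by ring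
    rw [h10] at h6'
    linarith [hcon'.1, hcon'.2]

/-- Almost surely, no multiple of the modulus `h ^ H * log (1 + 1 / h) ^ (1 / α)` bounds the
increments from `u` along all small dyadic lags. -/
lemma measure_forall_dyadic_increment_le (hX : IsHFSM P H α M X) [IsProbabilityMeasure P]
    (hH : 0 < H) (hα0 : 0 < α) (hα2 : α < 2) (u : ℝ) (n₀ : ℕ) {A : ℝ} (hA : 0 < A) :
    P {ω | ∀ i : ℕ, |X (u + ((2 : ℝ) ^ (n₀ + 1 + i))⁻¹) ω - X u ω|
      ≤ A * ((((2 : ℝ) ^ (n₀ + 1 + i))⁻¹) ^ H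
        * Real.log (1 + 2 ^ (n₀ + 1 + i)) ^ (1 / α))} = 0 := by
  have hM := hX.randomMeasure
  set a : ℕ → ℝ := fun i => (((2 : ℝ) ^ (n₀ + 1 + i))⁻¹) ^ H
        * Real.log (1 + 2 ^ (n₀ + 1 + i)) ^ (1 / α) with ha
  have hlog : ∀ j : ℕ, 0 < Real.log (1 + 2 ^ j) := fun j =>
    Real.log_pos (by linarith [show (0 : ℝ) < 2 ^ j by positivity])
  have ha0 : ∀ i, 0 < a i := fun i => mul_pos (by positivity) (Real.rpow_pos_of_pos (hlog _) _)
  obtain ⟨κ, hκ, hband⟩ := exists_le_lintegral_band hH hα0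
  choose f hf hfL hfP using fun i : ℕ =>
    hX.exists_approx_increment hα0 u (u + ((2 : ℝ) ^ (n₀ + 1 + i))⁻¹)
  let B : ℕ → Set ℝ := fun i => Set.Ico ((2 : ℝ) ^ (n₀ + 1 + i)) (2 ^ (n₀ + 1 + i + 1))
  have hBd : Pairwise (Function.onFun Disjoint B) :=
    ((pow_right_mono₀ one_le_two : Monotone fun k : ℕ => (2 : ℝ) ^ k).pairwise_disjoint_on_Ico_succ
      |>.comp_of_injective (f := fun i => n₀ + 1 + i) (add_right_injective _))
  have hmain : ∀ m : ℕ, 0 < m → P {ω | ∀ i : ℕ,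
      |X (u + ((2 : ℝ) ^ (n₀ + 1 + i))⁻¹) ω - X u ω| ≤ A * a i} ≤ 2 / m := by
    intro m hm
    obtain ⟨ζ, K, hK, hζ, hζK⟩ := exists_phases m
    -- Chosen so that a band part below `K * (2 * A * a i)` confines `M [0, 1]` to `(S i)ᶜ`: the
    -- factor `2` comes from `log_one_add_two_pow_le`, the divisor from `le_stableScale_restrict`.
    obtain ⟨K', hK'⟩ : ∃ K', K' = (K * (2 * A)) ^ α * 2 / (κ / 2 ^ α / 2) := ⟨_, rfl⟩
    have hK'0 : 0 < K' := by rw [hK']; positivity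
    let S : ℕ → Set Ω := fun i => {ω | K' * ((n₀ + 1 + i : ℕ) : ℝ) ≤ ‖M (Set.Icc 0 1) ω‖ ^ α}
    have hMm : Measurable (M (Set.Icc 0 1)) := hM.measurable _ measurableSet_Icc (by simp)
    have hS : ∀ i, MeasurableSet (S i) := fun i =>
      measurableSet_le measurable_const (hMm.norm.pow_const α)
    have hSsum : ∑' i, P (S i) = ⊤ := by
      have h1 := hM.tsum_measure_eq_top hα0 hα2 hK'0
      rw [← ENNReal.summable.sum_add_tsum_nat_add' (k := n₀ + 1)] at h1
      have h2 := (ENNReal.add_eq_top.1 h1).resolve_left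
        (ENNReal.sum_ne_top.2 fun _ _ => measure_ne_top _ _)
      rw [← h2]
      refine tsum_congr fun i => ?_
      simp only [S, add_comm i]
    have hN : ∀ N : ℕ, P {ω | ∀ i : Fin N,
        |X (u + ((2 : ℝ) ^ (n₀ + 1 + (i : ℕ)))⁻¹) ω - X u ω| ≤ A * a i}
          ≤ 2 / m + ∏ i : Fin N, P (S i)ᶜ := by
      intro N
      -- Doubling the bound leaves room `A * a i` for the error of approximating the increment by a
      -- simple integral.
      have hfin : ∀ᶠ n in atTop, P {ω | ∀ i : Fin N,
          |(simpleStochasticIntegral M (f i n) ω).re| ≤ 2 * A * a i}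
            ≤ 2 / m + ∏ i : Fin N, P (S i)ᶜ := by
        have hev : ∀ᶠ n in atTop, ∀ i : Fin N,
            ∫⁻ ξ, ‖f i n ξ - (hfsmKernel H α (u + ((2 : ℝ) ^ (n₀ + 1 + (i : ℕ)))⁻¹) ξ
              - hfsmKernel H α u ξ)‖ₑ ^ α
            ≤ ENNReal.ofReal (κ * (((2 : ℝ) ^ (n₀ + 1 + (i : ℕ)))⁻¹ ^ H) ^ α / 2 ^ α / 2) :=
          eventually_all.2 fun i => (hfL i).eventually_le_const
            (ENNReal.ofReal_pos.2 (by positivity))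
        filter_upwards [hev] with n hn
        refine (hM.measure_forall_abs_re_le hα0 hm hζK hζ (fun i : Fin N => hf i n)
          (B := fun i : Fin N => B i) (fun i => measurableSet_Ico)
          (fun i j hij => hBd fun h => hij (Fin.ext h))
          (b := fun i : Fin N => 2 * A * a i)
          (fun i => by have := ha0 i; positivity)).trans ?_
        refine add_le_add le_rfl (Finset.prod_le_prod' fun i _ => ?_)
        have hsc := le_stableScale_restrict hα0 (hf i n) (measurableSet_Ico (a :=
          (2 : ℝ) ^ (n₀ + 1 + (i : ℕ))) (b := 2 ^ (n₀ + 1 + (i : ℕ) + 1)))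
          (by positivity) (hband u (n₀ + 1 + i)) (hn i)
        refine (hM.measure_norm_integral_lt_le hα0
          (SimpleFunc.finMeasSupp_restrict (hf i n) measurableSet_Ico)
          hsc).trans (measure_mono fun ω hω => ?_)
        simp only [S, Set.mem_compl_iff, Set.mem_ofPred_eq, not_le] at hω ⊢
        set p : ℝ := ((2 : ℝ) ^ (n₀ + 1 + (i : ℕ)))⁻¹ ^ H with hp
        have hp0 : 0 < p := by positivity
        have hap : (a i) ^ α ≤ p ^ α * (2 * ((n₀ + 1 + i : ℕ) : ℝ)) := by
          simp only [ha]
          rw [Real.mul_rpow hp0.le (Real.rpow_nonneg (hlog _).le _), ← Real.rpow_mul (hlog _).le,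
            one_div_mul_cancel hα0.ne', Real.rpow_one]
          gcongr
          exact log_one_add_two_pow_le (by omega)
        have h1 : κ * p ^ α / 2 ^ α / 2 * ‖M (Set.Icc 0 1) ω‖ ^ α
            < (K * (2 * A)) ^ α * (p ^ α * (2 * ((n₀ + 1 + i : ℕ) : ℝ))) := by
          refine hω.trans_le ?_
          rw [← mul_assoc K, Real.mul_rpow (by positivity) (ha0 i).le]
          gcongr
        have h2 : κ * p ^ α / 2 ^ α / 2 * (K' * ((n₀ + 1 + i : ℕ) : ℝ))
            = (K * (2 * A)) ^ α * (p ^ α * (2 * ((n₀ + 1 + i : ℕ) : ℝ))) := by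
          rw [hK']
          field_simp
        rw [← h2] at h1
        exact lt_of_mul_lt_mul_left h1 (by positivity)
      have hlim : Tendsto (fun n => 2 / m + ∏ i : Fin N, P (S i)ᶜ + ∑ i : Fin N, P {ω | A * a i ≤
          |(simpleStochasticIntegral M (f i n) ω).re
            - (X (u + ((2 : ℝ) ^ (n₀ + 1 + (i : ℕ)))⁻¹) ω - X u ω)|}) atTop
          (𝓝 (2 / m + ∏ i : Fin N, P (S i)ᶜ + ∑ i : Fin N, 0)) :=
        tendsto_const_nhds.add (tendsto_finsetSum _ fun i _ =>
          hfP i _ (mul_pos hA (ha0 i)))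
      rw [Finset.sum_const_zero, add_zero] at hlim
      refine ge_of_tendsto hlim ?_
      filter_upwards [hfin] with n hn
      calc P {ω | ∀ i : Fin N, |X (u + ((2 : ℝ) ^ (n₀ + 1 + (i : ℕ)))⁻¹) ω - X u ω| ≤ A * a i}
          ≤ P ({ω | ∀ i : Fin N, |(simpleStochasticIntegral M (f i n) ω).re| ≤ 2 * A * a i} ∪
            ⋃ i : Fin N, {ω | A * a i ≤ |(simpleStochasticIntegral M (f i n) ω).re
              - (X (u + ((2 : ℝ) ^ (n₀ + 1 + (i : ℕ)))⁻¹) ω - X u ω)|}) := by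
            refine measure_mono fun ω hω => ?_
            by_contra hcon
            rw [Set.mem_union, not_or, Set.mem_iUnion, not_exists] at hcon
            refine hcon.1 fun i => ?_
            have h1 := hcon.2 i
            rw [Set.mem_ofPred_eq, not_le] at h1
            have h2 := hω i
            rw [abs_lt] at h1
            rw [abs_le] at h2 ⊢
            constructor <;> linarith [h1.1, h1.2, h2.1, h2.2]
        _ ≤ _ := (measure_union_le _ _).trans (add_le_add hn (measure_iUnion_fintype_le _ _))
    -- The limit in `N` comes before the one in `m`, since `K'` and the sets `S i` depend on the
    -- phases chosen for `m`.
    have hlim := (prod_measure_compl_tendsto_zero hS hSsum).const_add (2 / (m : ℝ≥0∞))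
    rw [add_zero] at hlim
    exact ge_of_tendsto' hlim fun N =>
      (measure_mono (Set.ofPred_subset_ofPred.2 fun ω hω (i : Fin N) => hω i)).trans (hN N)
  have hlim : Tendsto (fun m : ℕ => (2 : ℝ≥0∞) / m) atTop (𝓝 0) := by
    have := ENNReal.Tendsto.const_mul (a := 2) ENNReal.tendsto_inv_nat_nhds_zero (.inr (by simp))
    rwa [mul_zero] at this
  refine le_antisymm (ge_of_tendsto hlim ?_) zero_le
  filter_upwards [eventually_gt_atTop 0] with m hm using hmain m hm

end IsHFSM

theorem mainTheorem2 {Ω : Type*} [MeasurableSpace Ω] (P : Measure Ω) [IsProbabilityMeasure P]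
    (H α : ℝ) (hH0 : 0 < H) (hH1 : H < 1) (hα0 : 0 < α) (hα2 : α < 2)
    (M : Set ℝ → Ω → ℂ) (X : ℝ → Ω → ℝ) (hX : IsHFSM P H α M X)
    (u v : ℝ) (huv : u < v) :
    ∀ᵐ ω ∂P,
      (⨆ (s : ℝ) (t : ℝ) (_ : u ≤ s ∧ s < t ∧ t ≤ v),
        ENNReal.ofReal
          (|X s ω - X t ω| / (|s - t| ^ H * (Real.log (1 + |s - t|⁻¹)) ^ (1 / α)))) = ⊤ := by
  -- All lags `2 ^ (-(n₀ + 1 + i))` fit into `[u, v]`. The multiples `A + 1` below are positive and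
  -- countably many, so the null sets can be united.
  obtain ⟨n₀, hn₀⟩ := exists_pow_lt_of_lt_one (sub_pos.2 huv) (show (2 : ℝ)⁻¹ < 1 by norm_num)
  have hnull : ∀ᵐ ω ∂P, ∀ A : ℕ, ¬ ∀ i : ℕ, |X (u + ((2 : ℝ) ^ (n₀ + 1 + i))⁻¹) ω - X u ω|
      ≤ ((A : ℝ) + 1) * ((((2 : ℝ) ^ (n₀ + 1 + i))⁻¹) ^ H
        * Real.log (1 + 2 ^ (n₀ + 1 + i)) ^ (1 / α)) := by
    refine ae_all_iff.2 fun A => ?_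
    rw [ae_iff]
    simp only [not_not]
    exact hX.measure_forall_dyadic_increment_le hH0 hα0 hα2 u n₀ (by positivity)
  filter_upwards [hnull] with ω hω
  by_contra hne
  obtain ⟨A, hA⟩ := ENNReal.exists_nat_gt hne
  refine hω A fun i => ?_
  set h : ℝ := ((2 : ℝ) ^ (n₀ + 1 + i))⁻¹ with hh
  have h0 : 0 < h := by positivity
  have hv : u + h ≤ v := by
    have : h ≤ (2 : ℝ)⁻¹ ^ n₀ := by
      rw [hh, ← inv_pow]
      exact pow_le_pow_of_le_one (by norm_num) (by norm_num) (by omega)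
    linarith
  have h1 := (le_iSup₂_of_le (f := fun s t => ⨆ (_ : u ≤ s ∧ s < t ∧ t ≤ v), ENNReal.ofReal
    (|X s ω - X t ω| / (|s - t| ^ H * (Real.log (1 + |s - t|⁻¹)) ^ (1 / α)))) u (u + h)
    (le_iSup_of_le ⟨le_rfl, by linarith, hv⟩ le_rfl)).trans hA.le
  have habs : |u - (u + h)| = h := by rw [sub_add_cancel_left, abs_neg, abs_of_pos h0]
  have hinv : h⁻¹ = 2 ^ (n₀ + 1 + i) := by rw [hh, inv_inv]
  have hlog : 0 < Real.log (1 + 2 ^ (n₀ + 1 + i)) :=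
    Real.log_pos (by linarith [show (0 : ℝ) < 2 ^ (n₀ + 1 + i) by positivity])
  have hden : 0 < h ^ H * Real.log (1 + 2 ^ (n₀ + 1 + i)) ^ (1 / α) := by positivity
  rw [habs, hinv, ← ENNReal.ofReal_natCast, ENNReal.ofReal_le_ofReal_iff (by positivity),
    div_le_iff₀ hden, abs_sub_comm] at h1
  nlinarith
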